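/- Let $d\ge 3$ and let $\Box=\eta^{\mu\nu}\partial_\mu\partial_\nu$ be the wave operator on $\mathbb R^d$ with the Minkowski metric $\eta=\mathrm{diag}(-1,1,\dots,1)$. All differential operators are linear, of finite order, with smooth real coefficients, and $\dagger$ denotes the formal adjoint for $\int d^dx\, fg$ on functions of compact support. Consider wave functions $\phi=\phi_0(x)+c_0\phi_1(x)$, where $c_0$ is an odd variable of ghost number $1$, the BRST operator $\mathsf\Omega=c_0\Box$, and the odd symplectic form $\omega(\phi,\chi)=\int d^dx\,(\phi_0\chi_1-\phi_1\chi_0)$. An operator $M$ of parity $|M|$ on wave functions is called symplectic if $\omega(M\phi,\chi)+(-1)^{|M||\phi|}\omega(\phi,M\chi)=0$ for $\phi,\chi$ of compact support, $\phi$ of definite parity $|\phi|$ ($0$ for $\phi_0$, $1$ for $c_0\phi_1$). Let $$H^0([\mathsf\Omega,\cdot])=\{K:\ \mathrm{gh}(K)=0,\ [\mathsf\Omega,K]=0\}\big/\{\mathsf\Omega T+T\mathsf\Omega:\ \mathrm{gh}(T)=-1\},$$ an associative algebra, and let $H^0_{\rm sym}([\mathsf\Omega,\cdot])$ be the Lie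 algebra (under the commutator) defined by the same quotient with both $K$ and $T$ required to be symplectic. Write $K=A+B\,c_0\,\partial/\partial c_0$ for an operator of ghost number $0$. Let Eastwood's algebra be the algebra of differential operators $A$ such that $\Box A=\delta\Box$ for some differential operator $\delta$, modulo the operators $D\Box$. 1. (Variational symmetries of the massless real scalar.) $K\mapsto A$ is a bijection from the symplectic operators $K$ of ghost number $0$ with $[\mathsf\Omega,K]=0$ to the linear variational symmetries $\delta\phi=A\phi$ of the action $S[\phi]=\frac12\int d^dx\,\phi\,\Box\phi$, i.e. the differential operators $A$ for which $\frac{d}{d\varepsilon}S[\phi+\varepsilon A\phi]\big|_{\varepsilon=0}=0$ for all smooth $\phi$ of compact support. Such a $K$ is trivial in $H^0_{\rm sym}$ if and only if $A=D\Box$ with $D^\dagger=-D$. Thus $H^0_{\rm sym}([\mathsf\Omega,\cdot])$ is the Lie algebra of inequivalent linear variational symmetries. 2. (Relation to Eastwood's algebra.) $[K]\mapsto[A]$ is an isomorphism of algebras from $H^0([\mathsf\Omega,\cdot])$ to Eastwood's algebra. The natural map $H^0_{\rm sym}([\mathsf\Omega,\cdot])\to H^0([\mathsf\Omega,\cdot])$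 is an injective homomorphism of Lie algebras whose image is the anti-self-adjoint part, the set of classes $a$ with $a^\dagger=-a$. 3. (Classification.) There is a linear isomorphism $$\Phi:\ H^0_{\rm sym}([\mathsf\Omega,\cdot])\ \longrightarrow\ \bigoplus_{k\ \mathrm{odd}}\mathrm{CKT}_k$$ onto the space of conformal Killing tensors of odd rank, where $\mathrm{CKT}_k$ is the space of smooth symmetric trace-free tensor fields $V^{\mu_1\dots\mu_k}$ on $\mathbb R^d$ such that, with $V(x,p)=V^{\mu_1\dots\mu_k}(x)p_{\mu_1}\cdots p_{\mu_k}$, one has $p\cdot\partial_x V(x,p)=p^2\,W(x,p)$ for some $W$ polynomial in $p$ with smooth coefficients. This isomorphism is given by principal symbols: for $k$ odd, each $V\in\mathrm{CKT}_k$ is $\Phi[K]$ for some $K$ whose $A$ has order at most $k$ and order-$k$ symbol $V(x,p)$; and if $A$ has order at most $k$, then $\Phi[K]$ has no component of rank greater than $k$ and, for $k$ odd, the order-$k$ symbol of $A$ equals the rank-$k$ component of $\Phi[K]$ modulo multiples of $p^2$. -/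

import Mathlib

open scoped ContDiff DirectSum

attribute [local instance 100] LieRing.ofAssociativeRing

noncomputable section

namespace MasslessScalar

/-! ### Smooth functions and differential operators on Minkowski space -/

/-- The algebra of smooth real functions on `ℝ^d`. -/
def smoothSubalgebra (d : ℕ) : Subalgebra ℝ ((Fin d → ℝ) → ℝ) where
  carrier := {f | ContDiff ℝ ∞ f}
  mul_mem' {f g} (hf : ContDiff ℝ ∞ f) (hg : ContDiff ℝ ∞ g) := hf.mul hg
  add_mem' {f g} (hf : ContDiff ℝ ∞ f) (hg : ContDiff ℝ ∞ g) := hf.add hg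
  algebraMap_mem' c := (contDiff_const : ContDiff ℝ ∞ fun _ : Fin d → ℝ => c)

/-- Smooth real functions on `ℝ^d`. -/
def SmoothFn (d : ℕ) : Type := smoothSubalgebra d

instance (d : ℕ) : CommRing (SmoothFn d) := inferInstanceAs (CommRing (smoothSubalgebra d))

instance (d : ℕ) : Algebra ℝ (SmoothFn d) := inferInstanceAs (Algebra ℝ (smoothSubalgebra d))

theorem SmoothFn.contDiff {d : ℕ} (f : SmoothFn d) : ContDiff ℝ ∞ f.1 := f.2

theorem SmoothFn.differentiable {d : ℕ} (f : SmoothFn d) : Differentiable ℝ f.1 :=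
  f.contDiff.differentiable (by simp)

/-- The partial derivative `∂/∂x^i`. -/
def partialD {d : ℕ} (i : Fin d) : Module.End ℝ (SmoothFn d) where
  toFun f := ⟨fun x => fderiv ℝ f.1 x (Pi.single i 1),
    (f.contDiff.fderiv_right (m := ∞) (by simp)).clm_apply contDiff_const⟩
  map_add' f g := by
    apply Subtype.ext
    funext x
    change fderiv ℝ (f.1 + g.1) x _ = fderiv ℝ f.1 x _ + fderiv ℝ g.1 x _
    rw [fderiv_add (f.differentiable x) (g.differentiable x)]; rfl
  map_smul' c f := by
    apply Subtype.ext
    funext x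
    change fderiv ℝ (c • f.1) x _ = c • fderiv ℝ f.1 x _
    rw [fderiv_const_smul (f.differentiable x)]; rfl

/-- Multiplication by a smooth function. -/
def mulOp {d : ℕ} (a : SmoothFn d) : Module.End ℝ (SmoothFn d) := LinearMap.mulLeft ℝ a

/-- The algebra of linear differential operators with smooth real coefficients: the algebra of
operators on smooth functions generated by multiplications and partial derivatives. -/
def diffOpSubalgebra (d : ℕ) : Subalgebra ℝ (Module.End ℝ (SmoothFn d)) :=
  Algebra.adjoin ℝ (Set.range mulOp ∪ Set.range partialD)

/-- Linear differential operators with smooth real coefficients. -/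
def DiffOp (d : ℕ) : Type := diffOpSubalgebra d

instance (d : ℕ) : Ring (DiffOp d) := inferInstanceAs (Ring (diffOpSubalgebra d))

instance (d : ℕ) : Algebra ℝ (DiffOp d) := inferInstanceAs (Algebra ℝ (diffOpSubalgebra d))

/-- `∂/∂x^i` as a differential operator. -/
def partialOp {d : ℕ} (i : Fin d) : DiffOp d :=
  ⟨partialD i, Algebra.subset_adjoin (Or.inr ⟨i, rfl⟩)⟩

/-- The diagonal entries of the Minkowski metric `diag(-1, 1, …, 1)`. -/
def eta {d : ℕ} (i : Fin d) : ℝ := if (i : ℕ) = 0 then -1 else 1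

/-- The wave operator `□ = η^{μν} ∂_μ ∂_ν`. -/
def box (d : ℕ) : DiffOp d := ∑ i : Fin d, eta i • (partialOp i * partialOp i)

/-- Total symbols: polynomials `P(x,p)` in the momenta `p_1, …, p_d` with smooth coefficients. -/
abbrev Symb (d : ℕ) : Type := MvPolynomial (Fin d) (SmoothFn d)

/-- The iterated derivative `∂_1^{m_1} ⋯ ∂_d^{m_d}`. -/
def multiD {d : ℕ} (m : Fin d →₀ ℕ) : Module.End ℝ (SmoothFn d) :=
  ((List.finRange d).map fun i => partialD i ^ m i).prod

/-- The operator `P(x, ∂/∂x) = ∑_m a_m(x) ∂^m` with total symbol `P(x,p) = ∑_m a_m(x) p^m`. It has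
order at most `k` if `P.totalDegree ≤ k`, and then the symbol of order `k` is the homogeneous
component of degree `k` of `P`. -/
def symbolOp {d : ℕ} (P : Symb d) : Module.End ℝ (SmoothFn d) :=
  ∑ m ∈ P.support, mulOp (P.coeff m) * multiD m

/-! ### The action and its linear symmetries -/

/-- The action `S[φ] = ½ ∫ φ □φ`. -/
def action {d : ℕ} (φ : SmoothFn d) : ℝ :=
  (1 / 2) * ∫ x, φ.1 x * ((box d).1 φ).1 x

/-- `δφ = Aφ` is a linear variational symmetry: the first variation of the action along it vanishes
at every field of compact support. -/
def IsVariationalSymmetry {d : ℕ} (A : DiffOp d) : Prop :=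
  ∀ φ : SmoothFn d, HasCompactSupport φ.1 →
    HasDerivAt (fun ε : ℝ => action (φ + ε • A.1 φ)) 0 0

/-- `D† = -D` for the pairing `∫ f g`, on functions of compact support. -/
def IsAntiSelfAdjointOp {d : ℕ} (D : DiffOp d) : Prop :=
  ∀ f g : SmoothFn d, HasCompactSupport f.1 → HasCompactSupport g.1 →
    ∫ x, (D.1 f).1 x * g.1 x = - ∫ x, f.1 x * (D.1 g).1 x

/-- Operators `A` with `□ A = δ □` for some differential operator `δ`: linear symmetries of the
equation `□φ = 0`. -/
def eomSubalgebra (d : ℕ) : Subalgebra ℝ (DiffOp d) where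
  carrier := {A | ∃ δ : DiffOp d, box d * A = δ * box d}
  mul_mem' := by
    rintro A A' ⟨δ, h⟩ ⟨δ', h'⟩
    exact ⟨δ * δ', by rw [← mul_assoc, h, mul_assoc, h', mul_assoc]⟩
  add_mem' := by
    rintro A A' ⟨δ, h⟩ ⟨δ', h'⟩
    exact ⟨δ + δ', by rw [mul_add, h, h', add_mul]⟩
  algebraMap_mem' r := ⟨algebraMap ℝ _ r, (Algebra.commutes r (box d)).symm⟩

/-- Linear symmetries of the equation `□φ = 0`. -/
def EomSymmetry (d : ℕ) : Type := eomSubalgebra d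

instance (d : ℕ) : Ring (EomSymmetry d) := inferInstanceAs (Ring (eomSubalgebra d))

instance (d : ℕ) : Algebra ℝ (EomSymmetry d) := inferInstanceAs (Algebra ℝ (eomSubalgebra d))

/-- The ideal of trivial symmetries `D □`. -/
def eomTrivial (d : ℕ) : Ideal (EomSymmetry d) where
  carrier := {A | ∃ D : DiffOp d, A.1 = D * box d}
  add_mem' := by
    rintro A A' ⟨D, h⟩ ⟨D', h'⟩
    exact ⟨D + D', by rw [add_mul, ← h, ← h']; rfl⟩
  zero_mem' := ⟨0, (zero_mul (box d)).symm⟩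
  smul_mem' := by
    rintro C A ⟨D, h⟩
    exact ⟨C.1 * D, by rw [mul_assoc, ← h]; rfl⟩

instance (d : ℕ) : (eomTrivial d).IsTwoSided where
  mul_mem_of_left := by
    rintro A C ⟨D, h⟩
    obtain ⟨δ, hδ⟩ := C.2
    exact ⟨D * δ, by
      change A.1 * C.1 = _
      rw [h, mul_assoc, hδ, mul_assoc]⟩

/-- Eastwood's algebra of symmetries of the (flat, Lorentzian) Laplacian: operators `A` with
`□ A = δ □`, modulo operators `D □`, under composition. -/
abbrev EastwoodAlgebra (d : ℕ) : Type := EomSymmetry d ⧸ eomTrivial d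

/-! ### BRST operators

Wave functions `φ = φ₀(x) + c₀ φ₁(x)` are pairs of functions; `φ₀` has ghost number `0` (even) and
`c₀ φ₁` has ghost number `1` (odd). Operators are matrices of differential operators. -/

/-- Wave functions `φ₀ + c₀ φ₁`. -/
abbrev WaveFn (d : ℕ) : Type := Fin 2 → SmoothFn d

/-- Operators on wave functions. -/
abbrev Op (d : ℕ) : Type := Matrix (Fin 2) (Fin 2) (DiffOp d)

/-- The action of operators on wave functions. -/
def Op.act {d : ℕ} (M : Op d) (φ : WaveFn d) : WaveFn d := fun a => ∑ b, (M a b).1 (φ b)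

/-- Multiplication by the ghost `c₀`. -/
def ghostC (d : ℕ) : Op d := !![0, 0; 1, 0]

/-- The derivative `∂/∂c₀`. -/
def ghostD (d : ℕ) : Op d := !![0, 1; 0, 0]

/-- The ghost number operator `c₀ ∂/∂c₀`. -/
def ghostNumber (d : ℕ) : Op d := ghostC d * ghostD d

/-- The BRST operator `Ω = c₀ □`. -/
def brst (d : ℕ) : Op d := ghostC d * Matrix.diagonal fun _ => box d

/-- The operator `M` has ghost number `g`. -/
def HasGhostNumber {d : ℕ} (g : ℤ) (M : Op d) : Prop :=
  ghostNumber d * M - M * ghostNumber d = g • M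

/-- Wave functions of compact support. -/
def IsTest {d : ℕ} (φ : WaveFn d) : Prop := ∀ a, HasCompactSupport (φ a).1

/-- The odd symplectic form `ω(φ, χ) = ∫ (φ₀ χ₁ - φ₁ χ₀)`. -/
def omega {d : ℕ} (φ χ : WaveFn d) : ℝ :=
  ∫ x, ((φ 0).1 x * (χ 1).1 x - (φ 1).1 x * (χ 0).1 x)

/-- The sign `(-1)^{p |φ|}`, extended linearly: `φ₀ + c₀ φ₁ ↦ φ₀ + (-1)^p c₀ φ₁`. -/
def paritySign {d : ℕ} (p : ℕ) (φ : WaveFn d) : WaveFn d :=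
  fun a => ((-1 : ℝ) ^ (p * (a : ℕ))) • φ a

/-- An operator `M` of parity `p` is symplectic: `ω(Mφ, χ) + (-1)^{p |φ|} ω(φ, Mχ) = 0`. -/
def IsSymplectic {d : ℕ} (p : ℕ) (M : Op d) : Prop :=
  ∀ φ χ : WaveFn d, IsTest φ → IsTest χ →
    omega (M.act φ) χ + omega (paritySign p φ) (M.act χ) = 0

/-! ### BRST operator cohomology in ghost number zero -/

/-- Operators of ghost number `0` commuting with `Ω`. -/
def cocycleSubalgebra (d : ℕ) : Subalgebra ℝ (Op d) where
  carrier := {K | HasGhostNumber 0 K ∧ brst d * K - K * brst d = 0}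
  mul_mem' := by
    rintro K L ⟨hK, hK'⟩ ⟨hL, hL'⟩
    simp only [HasGhostNumber, zero_smul, sub_eq_zero] at *
    exact ⟨by rw [← mul_assoc, hK, mul_assoc, hL, mul_assoc],
      by rw [← mul_assoc, hK', mul_assoc, hL', mul_assoc]⟩
  add_mem' := by
    rintro K L ⟨hK, hK'⟩ ⟨hL, hL'⟩
    simp only [HasGhostNumber, zero_smul, sub_eq_zero] at *
    exact ⟨by rw [mul_add, add_mul, hK, hL], by rw [mul_add, add_mul, hK', hL']⟩
  algebraMap_mem' r := by
    simp only [HasGhostNumber, zero_smul, sub_eq_zero]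
    exact ⟨(Algebra.commutes r _).symm, (Algebra.commutes r _).symm⟩

/-- Cocycles of `[Ω, ·]` in ghost number `0`. -/
def Cocycle (d : ℕ) : Type := cocycleSubalgebra d

instance (d : ℕ) : Ring (Cocycle d) := inferInstanceAs (Ring (cocycleSubalgebra d))

instance (d : ℕ) : Algebra ℝ (Cocycle d) := inferInstanceAs (Algebra ℝ (cocycleSubalgebra d))

theorem HasGhostNumber.mul {d : ℕ} {a b : ℤ} {M N : Op d} (hM : HasGhostNumber a M)
    (hN : HasGhostNumber b N) : HasGhostNumber (a + b) (M * N) := by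
  unfold HasGhostNumber at *
  have : ghostNumber d * (M * N) - M * N * ghostNumber d
      = (ghostNumber d * M - M * ghostNumber d) * N
        + M * (ghostNumber d * N - N * ghostNumber d) := by noncomm_ring
  rw [this, hM, hN, add_smul, smul_mul_assoc, mul_smul_comm]

theorem HasGhostNumber.add {d : ℕ} {a : ℤ} {M N : Op d} (hM : HasGhostNumber a M)
    (hN : HasGhostNumber a N) : HasGhostNumber a (M + N) := by
  unfold HasGhostNumber at *
  rw [smul_add, ← hM, ← hN]; noncomm_ring

theorem HasGhostNumber.smul {d : ℕ} {a : ℤ} {M : Op d} (c : ℝ) (hM : HasGhostNumber a M) :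
    HasGhostNumber a (c • M) := by
  unfold HasGhostNumber at *
  rw [smul_comm, ← hM, smul_sub, mul_smul_comm, smul_mul_assoc]

theorem HasGhostNumber.zero {d : ℕ} {a : ℤ} : HasGhostNumber a (0 : Op d) := by
  simp [HasGhostNumber]

theorem HasGhostNumber.sub {d : ℕ} {a : ℤ} {M N : Op d} (hM : HasGhostNumber a M)
    (hN : HasGhostNumber a N) : HasGhostNumber a (M - N) := by
  have := hM.add (hN.smul (-1))
  simpa [sub_eq_add_neg] using this

/-- The ideal of coboundaries `[Ω, T] = ΩT + TΩ`, with `T` (odd) of ghost number `-1`. -/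
def coboundaries (d : ℕ) : Ideal (Cocycle d) where
  carrier := {K | ∃ T : Op d, HasGhostNumber (-1) T ∧ K.1 = brst d * T + T * brst d}
  add_mem' := by
    rintro K L ⟨T, hT, h⟩ ⟨T', hT', h'⟩
    refine ⟨T + T', hT.add hT', ?_⟩
    change K.1 + L.1 = _
    rw [h, h']; noncomm_ring
  zero_mem' := ⟨0, .zero, by rw [mul_zero, zero_mul, add_zero]; rfl⟩
  smul_mem' := by
    rintro C K ⟨T, hT, h⟩
    have hC : brst d * C.1 = C.1 * brst d := sub_eq_zero.1 C.2.2
    refine ⟨C.1 * T, by simpa using C.2.1.mul hT, ?_⟩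
    change C.1 * K.1 = _
    rw [h, ← mul_assoc, hC]; noncomm_ring

instance (d : ℕ) : (coboundaries d).IsTwoSided where
  mul_mem_of_left := by
    rintro K C ⟨T, hT, h⟩
    have hC : brst d * C.1 = C.1 * brst d := sub_eq_zero.1 C.2.2
    refine ⟨T * C.1, by simpa using hT.mul C.2.1, ?_⟩
    change K.1 * C.1 = _
    rw [h, mul_assoc T, ← hC]; noncomm_ring

/-- The associative algebra `H⁰([Ω, ·])`. -/
abbrev Cohomology (d : ℕ) : Type := Cocycle d ⧸ coboundaries d

/-- The class `a` satisfies `a† = -a`: it has a representative `K` whose adjoint is cohomologous to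
`-K`. (For operators of ghost number `0` the relation below says that `K'` is the adjoint of `K`,
both for `ω` and for the symmetric inner product `∫ (φ₀ χ₁ + φ₁ χ₀)`.) -/
def IsAntiSelfAdjointClass {d : ℕ} (a : Cohomology d) : Prop :=
  ∃ K K' : Cocycle d, Ideal.Quotient.mk (coboundaries d) K = a ∧
    Ideal.Quotient.mk (coboundaries d) K' = -a ∧
    ∀ φ χ : WaveFn d, IsTest φ → IsTest χ → omega (Op.act K.1 φ) χ = omega φ (Op.act K'.1 χ)

/-! ### The symplectic part -/

theorem hasCompactSupport_diffOp {d : ℕ} (A : DiffOp d) {f : SmoothFn d}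
    (hf : HasCompactSupport f.1) : HasCompactSupport (A.1 f).1 := by
  obtain ⟨A, hA⟩ := A
  change HasCompactSupport (A f).1
  unfold diffOpSubalgebra at hA
  induction hA using Algebra.adjoin_induction generalizing f with
  | mem A hA =>
    rcases hA with ⟨a, rfl⟩ | ⟨i, rfl⟩
    · exact HasCompactSupport.mul_left (f := a.1) hf
    · exact HasCompactSupport.fderiv_apply (𝕜 := ℝ) hf _
  | algebraMap r => exact HasCompactSupport.mul_left (f := fun _ => r) hf
  | add A B _ _ hA hB => exact HasCompactSupport.add (hA hf) (hB hf)
  | mul A B _ _ hA hB => exact hA (hB hf)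

theorem hasCompactSupport_add {d : ℕ} {f g : SmoothFn d} (hf : HasCompactSupport f.1)
    (hg : HasCompactSupport g.1) : HasCompactSupport (f + g).1 := HasCompactSupport.add hf hg

theorem IsTest.act {d : ℕ} (M : Op d) {φ : WaveFn d} (hφ : IsTest φ) : IsTest (M.act φ) := by
  intro a
  unfold Op.act
  rw [Fin.sum_univ_two]
  exact hasCompactSupport_add (hasCompactSupport_diffOp _ (hφ 0))
    (hasCompactSupport_diffOp _ (hφ 1))

theorem IsTest.paritySign {d : ℕ} (p : ℕ) {φ : WaveFn d} (hφ : IsTest φ) :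
    IsTest (paritySign p φ) := fun a =>
  HasCompactSupport.mul_left (f := fun _ => (-1 : ℝ) ^ (p * (a : ℕ))) (hφ a)

theorem act_add {d : ℕ} (M N : Op d) (φ : WaveFn d) : (M + N).act φ = M.act φ + N.act φ := by
  funext a
  simp only [Op.act, Pi.add_apply, Matrix.add_apply, ← Finset.sum_add_distrib]
  rfl

theorem act_smul {d : ℕ} (c : ℝ) (M : Op d) (φ : WaveFn d) : (c • M).act φ = c • M.act φ := by
  funext a
  simp only [Op.act, Pi.smul_apply, Matrix.smul_apply, Finset.smul_sum]
  rfl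

theorem act_zero {d : ℕ} (φ : WaveFn d) : (0 : Op d).act φ = 0 := by
  simpa using act_smul 0 (0 : Op d) φ

theorem act_sub {d : ℕ} (M N : Op d) (φ : WaveFn d) : (M - N).act φ = M.act φ - N.act φ := by
  have := act_add M ((-1 : ℝ) • N) φ
  rw [act_smul] at this
  simpa [sub_eq_add_neg] using this

theorem act_mul {d : ℕ} (M N : Op d) (φ : WaveFn d) : Op.act (M * N) φ = M.act (N.act φ) := by
  funext a
  simp only [Op.act, Matrix.mul_apply, Fin.sum_univ_two, map_add]
  change (M a 0).1 ((N 0 0).1 (φ 0)) + (M a 1).1 ((N 1 0).1 (φ 0))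
    + ((M a 0).1 ((N 0 1).1 (φ 1)) + (M a 1).1 ((N 1 1).1 (φ 1))) = _
  abel

theorem integrable_mul {d : ℕ} {f g : SmoothFn d} (hf : HasCompactSupport f.1) :
    MeasureTheory.Integrable (fun x => f.1 x * g.1 x) :=
  (f.contDiff.continuous.mul g.contDiff.continuous).integrable_of_hasCompactSupport
    (HasCompactSupport.mul_right hf)

theorem omega_add_left {d : ℕ} {φ ψ : WaveFn d} (χ : WaveFn d) (hφ : IsTest φ) (hψ : IsTest ψ) :
    omega (φ + ψ) χ = omega φ χ + omega ψ χ := by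
  unfold omega
  rw [← MeasureTheory.integral_add]
  · congr 1; funext x
    change ((φ 0).1 x + (ψ 0).1 x) * _ - ((φ 1).1 x + (ψ 1).1 x) * _ = _
    ring
  · exact (integrable_mul (hφ 0)).sub (integrable_mul (hφ 1))
  · exact (integrable_mul (hψ 0)).sub (integrable_mul (hψ 1))

theorem omega_smul_left {d : ℕ} (c : ℝ) (φ χ : WaveFn d) :
    omega (c • φ) χ = c * omega φ χ := by
  unfold omega
  rw [← MeasureTheory.integral_const_mul]
  congr 1; funext x
  change (c * (φ 0).1 x) * _ - (c * (φ 1).1 x) * _ = _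
  ring

theorem omega_swap {d : ℕ} (φ χ : WaveFn d) : omega φ χ = - omega χ φ := by
  unfold omega
  rw [← MeasureTheory.integral_neg]
  congr 1; funext x; ring

theorem omega_add_right {d : ℕ} (φ : WaveFn d) {χ ψ : WaveFn d} (hχ : IsTest χ) (hψ : IsTest ψ) :
    omega φ (χ + ψ) = omega φ χ + omega φ ψ := by
  rw [omega_swap, omega_add_left _ hχ hψ, omega_swap χ, omega_swap ψ]; ring

theorem omega_smul_right {d : ℕ} (c : ℝ) (φ χ : WaveFn d) :
    omega φ (c • χ) = c * omega φ χ := by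
  rw [omega_swap, omega_smul_left, omega_swap χ]; ring

theorem omega_sub_left {d : ℕ} {φ ψ : WaveFn d} (χ : WaveFn d) (hφ : IsTest φ) (hψ : IsTest ψ) :
    omega (φ - ψ) χ = omega φ χ - omega ψ χ := by
  have h := omega_add_left (φ := φ - ψ) χ (fun a => by
    have := hasCompactSupport_add (hφ a) (g := (-1 : ℝ) • ψ a)
      (HasCompactSupport.mul_left (f := fun _ => (-1 : ℝ)) (hψ a))
    simpa [sub_eq_add_neg] using this) hψ
  rw [sub_add_cancel] at h
  linarith

theorem IsTest.sub {d : ℕ} {φ ψ : WaveFn d} (hφ : IsTest φ) (hψ : IsTest ψ) : IsTest (φ - ψ) :=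
  fun a => by
    have := hasCompactSupport_add (hφ a) (g := (-1 : ℝ) • ψ a)
      (HasCompactSupport.mul_left (f := fun _ => (-1 : ℝ)) (hψ a))
    simpa [sub_eq_add_neg] using this

theorem omega_sub_right {d : ℕ} (φ : WaveFn d) {χ ψ : WaveFn d} (hχ : IsTest χ) (hψ : IsTest ψ) :
    omega φ (χ - ψ) = omega φ χ - omega φ ψ := by
  rw [omega_swap, omega_sub_left _ hχ hψ, omega_swap χ, omega_swap ψ]; ring

theorem paritySign_zero {d : ℕ} (φ : WaveFn d) : paritySign 0 φ = φ := by
  funext a; simp [paritySign]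

theorem entries_of_ghost_zero {d : ℕ} {K : Op d} (h : HasGhostNumber 0 K) :
    K 0 1 = 0 ∧ K 1 0 = 0 := by
  unfold HasGhostNumber ghostNumber ghostC ghostD at h
  rw [zero_smul] at h
  have e : (!![0, 0; 1, 0] * !![0, 1; 0, 0] : Op d) = !![0, 0; 0, 1] := by
    ext a b : 2
    fin_cases a <;> fin_cases b <;> simp [Matrix.mul_apply]
  rw [e, Matrix.eta_fin_two K] at h
  have h1 := congrFun (congrFun h 0) 1
  have h2 := congrFun (congrFun h 1) 0
  simp at h1 h2
  exact ⟨h1, h2⟩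

theorem paritySign_act {d : ℕ} (p : ℕ) {K : Op d} (h : HasGhostNumber 0 K) (φ : WaveFn d) :
    paritySign p (K.act φ) = K.act (paritySign p φ) := by
  obtain ⟨h1, h2⟩ := entries_of_ghost_zero h
  funext a
  have z : ∀ f : SmoothFn d, (0 : DiffOp d).1 f = 0 := fun f => rfl
  fin_cases a <;> simp [paritySign, Op.act, Fin.sum_univ_two, h1, h2, z]

theorem IsSymplectic.add {d p : ℕ} {M N : Op d} (hM : IsSymplectic p M) (hN : IsSymplectic p N) :
    IsSymplectic p (M + N) := by
  intro φ χ hφ hχ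
  rw [act_add, act_add, omega_add_left _ (hφ.act M) (hφ.act N),
    omega_add_right _ (hχ.act M) (hχ.act N)]
  linarith [hM φ χ hφ hχ, hN φ χ hφ hχ]

theorem IsSymplectic.smul {d p : ℕ} {M : Op d} (c : ℝ) (hM : IsSymplectic p M) :
    IsSymplectic p (c • M) := by
  intro φ χ hφ hχ
  rw [act_smul, act_smul, omega_smul_left, omega_smul_right, ← mul_add, hM φ χ hφ hχ, mul_zero]

theorem IsSymplectic.zero {d p : ℕ} : IsSymplectic p (0 : Op d) := by
  intro φ χ _ _
  have h1 := omega_smul_left 0 (0 : WaveFn d) χ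
  have h2 := omega_smul_right 0 (paritySign p φ) (0 : WaveFn d)
  rw [smul_zero, zero_mul] at h1 h2
  rw [act_zero, act_zero, h1, h2, add_zero]

/-- The commutator of an even with a (even or odd) symplectic operator is symplectic. -/
theorem IsSymplectic.commutator {d p : ℕ} {K M : Op d} (hg : HasGhostNumber 0 K)
    (hK : IsSymplectic 0 K) (hM : IsSymplectic p M) : IsSymplectic p (K * M - M * K) := by
  intro φ χ hφ hχ
  rw [act_sub, act_sub, act_mul, act_mul, act_mul, act_mul,
    omega_sub_left _ ((hφ.act M).act K) ((hφ.act K).act M),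
    omega_sub_right _ ((hχ.act M).act K) ((hχ.act K).act M)]
  have e1 := hK (M.act φ) χ (hφ.act M) hχ
  have e2 := hM φ (K.act χ) hφ (hχ.act K)
  have e3 := hM (K.act φ) χ (hφ.act K) hχ
  have e4 := hK (paritySign p φ) (M.act χ) (hφ.paritySign p) (hχ.act M)
  rw [paritySign_zero] at e1 e4
  rw [paritySign_act p hg] at e3
  linarith

/-- Symplectic operators of ghost number `0` commuting with `Ω`, with the commutator. -/
def symCocycles (d : ℕ) : LieSubalgebra ℝ (Op d) where
  carrier := {K | HasGhostNumber 0 K ∧ IsSymplectic 0 K ∧ brst d * K - K * brst d = 0}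
  add_mem' := by
    rintro K L ⟨hK, hK', hK''⟩ ⟨hL, hL', hL''⟩
    exact ⟨hK.add hL, hK'.add hL', ((cocycleSubalgebra d).add_mem ⟨hK, hK''⟩ ⟨hL, hL''⟩).2⟩
  zero_mem' := ⟨.zero, .zero, by simp⟩
  smul_mem' := by
    rintro c K ⟨hK, hK', hK''⟩
    exact ⟨hK.smul c, hK'.smul c, ((cocycleSubalgebra d).smul_mem ⟨hK, hK''⟩ c).2⟩
  lie_mem' := by
    rintro K L ⟨hK, hK', hK''⟩ ⟨hL, hL', hL''⟩
    have hm := (cocycleSubalgebra d).sub_mem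
      ((cocycleSubalgebra d).mul_mem ⟨hK, hK''⟩ ⟨hL, hL''⟩)
      ((cocycleSubalgebra d).mul_mem ⟨hL, hL''⟩ ⟨hK, hK''⟩)
    exact ⟨hm.1, IsSymplectic.commutator hK hK' hL', hm.2⟩

/-- The Lie ideal of trivial elements `[Ω, T] = ΩT + TΩ`, with `T` symplectic (odd) of ghost number
`-1`. -/
def symCoboundaries (d : ℕ) : LieIdeal ℝ (symCocycles d) where
  carrier := {K | ∃ T : Op d, HasGhostNumber (-1) T ∧ IsSymplectic 1 T ∧
    K.1 = brst d * T + T * brst d}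
  add_mem' := by
    rintro K L ⟨T, hT, hs, h⟩ ⟨T', hT', hs', h'⟩
    refine ⟨T + T', hT.add hT', hs.add hs', ?_⟩
    change K.1 + L.1 = _
    rw [h, h']; noncomm_ring
  zero_mem' := ⟨0, .zero, .zero, by rw [mul_zero, zero_mul, add_zero]; rfl⟩
  smul_mem' := by
    rintro c K ⟨T, hT, hs, h⟩
    refine ⟨c • T, hT.smul c, hs.smul c, ?_⟩
    change c • K.1 = _
    rw [h, smul_add, mul_smul_comm, smul_mul_assoc]
  lie_mem := by
    rintro C K ⟨T, hT, hs, h⟩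
    have hC : brst d * C.1 = C.1 * brst d := sub_eq_zero.1 C.2.2.2
    refine ⟨C.1 * T - T * C.1, ?_, IsSymplectic.commutator C.2.1 C.2.2.1 hs, ?_⟩
    · have h1 := C.2.1.mul hT
      have h2 := hT.mul C.2.1
      rw [zero_add] at h1
      rw [add_zero] at h2
      exact h1.sub h2
    · change C.1 * K.1 - K.1 * C.1 = _
      have hT1 : brst d * (C.1 * T) = C.1 * (brst d * T) := by rw [← mul_assoc, hC, mul_assoc]
      have hT2 : T * (C.1 * brst d) = T * (brst d * C.1) := by rw [hC]
      rw [h, mul_sub, sub_mul, hT1, mul_assoc T C.1, hT2]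
      noncomm_ring

/-- The Lie algebra `H⁰_sym([Ω, ·])` of inequivalent linear variational symmetries. -/
abbrev SymCohomology (d : ℕ) : Type := symCocycles d ⧸ symCoboundaries d

/-- The class of a symplectic cocycle. -/
def SymCohomology.mk {d : ℕ} (K : symCocycles d) : SymCohomology d :=
  LieSubmodule.Quotient.mk (N := symCoboundaries d) K

/-! ### Conformal Killing tensors

A symmetric tensor field `V^{μ₁…μ_k}(x)` is identified with the homogeneous polynomial
`V(x,p) = V^{μ₁…μ_k}(x) p_{μ₁} ⋯ p_{μ_k}`. -/

/-- `∂/∂x^i` acting on the coefficients of a polynomial in `p`. -/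
def coeffD {d : ℕ} (i : Fin d) (V : Symb d) : Symb d :=
  ∑ m ∈ V.support, MvPolynomial.monomial m (partialD i (V.coeff m))

/-- `p² = η^{μν} p_μ p_ν`. -/
def pSq (d : ℕ) : Symb d := ∑ i : Fin d, eta i • (MvPolynomial.X i * MvPolynomial.X i)

/-- `p · ∂/∂x = η^{μν} p_μ ∂/∂x^ν`, the symmetrised gradient. -/
def pGrad {d : ℕ} (V : Symb d) : Symb d := ∑ i : Fin d, eta i • (MvPolynomial.X i * coeffD i V)

/-- `η_{μν} ∂²/∂p_μ ∂p_ν`, the trace up to a nonzero factor. -/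
def trace {d : ℕ} (V : Symb d) : Symb d :=
  ∑ i : Fin d, eta i • MvPolynomial.pderiv i (MvPolynomial.pderiv i V)

theorem coeff_coeffD {d : ℕ} (i : Fin d) (V : Symb d) (m : Fin d →₀ ℕ) :
    (coeffD i V).coeff m = partialD i (V.coeff m) := by
  classical
  unfold coeffD
  rw [MvPolynomial.coeff_sum]
  simp only [MvPolynomial.coeff_monomial]
  rw [Finset.sum_ite_eq']
  split_ifs with h
  · rfl
  · rw [MvPolynomial.notMem_support_iff.1 h, map_zero]

theorem coeffD_add {d : ℕ} (i : Fin d) (V W : Symb d) :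
    coeffD i (V + W) = coeffD i V + coeffD i W := by
  ext m : 1
  simp [coeff_coeffD]

theorem coeffD_smul {d : ℕ} (i : Fin d) (c : ℝ) (V : Symb d) :
    coeffD i (c • V) = c • coeffD i V := by
  ext m : 1
  simp [coeff_coeffD]

theorem pGrad_add {d : ℕ} (V W : Symb d) : pGrad (V + W) = pGrad V + pGrad W := by
  simp [pGrad, coeffD_add, mul_add, Finset.sum_add_distrib]

theorem pGrad_smul {d : ℕ} (c : ℝ) (V : Symb d) : pGrad (c • V) = c • pGrad V := by
  simp [pGrad, coeffD_smul, Finset.smul_sum, smul_comm c]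

theorem trace_add {d : ℕ} (V W : Symb d) : trace (V + W) = trace V + trace W := by
  simp [trace, Finset.sum_add_distrib]

theorem trace_smul {d : ℕ} (c : ℝ) (V : Symb d) : trace (c • V) = c • trace V := by
  simp [trace, Finset.smul_sum, smul_comm c]

/-- The space of conformal Killing tensors of rank `k`: symmetric trace-free tensor fields `V` of
rank `k` such that `∂^{(μ} V^{ν…ρ)} = η^{(μν} W^{…ρ)}` for some `W`. -/
def conformalKilling (d k : ℕ) : Submodule ℝ (Symb d) where
  carrier := {V | V.IsHomogeneous k ∧ trace V = 0 ∧ ∃ W : Symb d, pGrad V = pSq d * W}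
  add_mem' := by
    rintro V V' ⟨h, t, W, e⟩ ⟨h', t', W', e'⟩
    exact ⟨h.add h', by rw [trace_add, t, t', add_zero], W + W', by rw [pGrad_add, e, e', mul_add]⟩
  zero_mem' := ⟨MvPolynomial.isHomogeneous_zero _ _ _, by simp [trace], 0, by
    simpa using pGrad_smul 0 (0 : Symb d)⟩
  smul_mem' := by
    rintro c V ⟨h, t, W, e⟩
    refine ⟨?_, by rw [trace_smul, t, smul_zero], c • W, by rw [pGrad_smul, e, mul_smul_comm]⟩
    rw [← algebraMap_smul (SmoothFn d) c V]
    exact (MvPolynomial.homogeneousSubmodule (Fin d) (SmoothFn d) k).smul_mem _ h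

/-- The space of conformal Killing tensors of odd rank. -/
abbrev OddConformalKilling (d : ℕ) : Type :=
  ⨁ k : {k : ℕ // Odd k}, conformalKilling d k

end MasslessScalar

end

open MasslessScalar

/-!
The ghost-number-zero cocycles of `[Ω, ·]` are the pairs `K = diag(A, B)` with `□ A = B □`, the
coboundaries are `diag(D □, □ D)`, and `K` is symplectic exactly when `B = -A†`. Right
multiplication by `□` is injective on differential operators, so `B` is determined by `A`; hence
cocycles are the symmetries of the wave equation (`cocycleEquivEom`), and the symplectic ones are
the `A` for which `□ A` is anti-self-adjoint, i.e. the variational symmetries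
(`isVariationalSymmetry_iff_existsUnique`). If a symplectic `K` has `A = D □`, adjunction and the
cancellation of `□` force `D† = -D`, which makes `H⁰_sym → H⁰` injective
(`symCocycles_mem_coboundaries_iff'`). A class with `a† = -a`, represented by `K` with adjoint `K'`
cohomologous to `-K`, is also represented by the symplectic `(K - K') / 2`.

Differential operators are handled through their total symbols: `normalOrder` is a linear bijection
from polynomials `P(x,p)` to operators, with `P(x,∂) □ = (p² P)(x,∂)` and
`□ P(x,∂) = (p² P + 2 p·∂_x P + □_x P)(x,∂)`. So `A` with symbol `P` is a symmetry exactly when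
`2 p·∂_x P + □_x P` is a multiple of `p²`. The top part of this condition, together with the
decomposition of polynomials into trace-free ones and multiples of `p²`
(`exists_trace_free_add_pSq_mul`), says that the trace-free part of the principal symbol is a
conformal Killing tensor. A multiple of `p²` in odd order is removed by a trivial symmetry, and in
even order the principal symbol of a variational symmetry vanishes, because the adjoint changes it
by `(-1)^k`. Descent on the order then bounds the classes by conformal Killing tensors of odd rank
(`exists_conformalClass_eq`).

Conversely a conformal Killing tensor `V` of rank `k` has to be quantised
(`exists_symbol_of_conformalKilling`). Write `Div = ∂_x·∂_p` and `N = d + 2k - 2`. Taking a trace of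
the conformal Killing equation gives `N p·∂_x V = p² Div V`, and `[Div, p·∂_x] = □_x`,
`[Div, p²] = 2 p·∂_x` turn this into
`(N - 2j) p·∂_x Div^j V + j (N - j + 1) □_x Div^{j-1} V = p² Div^{j+1} V`.
Hence the coefficients in `A = V + ∑_{j ≥ 1} t_j Div^j V` can be chosen one after the other so that
`2 p·∂_x A + □_x A` becomes a multiple of `p²`; the only divisions are by `j (N - j + 1)`, which is
nonzero for `1 ≤ j ≤ k + 1` when `d ≥ 3`. Passing to the anti-self-adjoint part keeps the principal
symbol for odd `k`. Injectivity holds because a trivial symmetry has symbol in `(p²)`, and a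
trace-free multiple of `p²` is zero (`eq_zero_of_trace_eq_zero_of_eq_pSq_mul`).
-/

noncomputable section

namespace MasslessScalar

open MvPolynomial MeasureTheory

/-! ### Calculus on smooth functions -/

theorem SmoothFn.ext {d : ℕ} {f g : SmoothFn d} (h : ∀ x, f.1 x = g.1 x) : f = g :=
  Subtype.ext (funext h)

/-- Evaluation of smooth functions at a point. -/
def evalAt {d : ℕ} (x : Fin d → ℝ) : SmoothFn d →ₐ[ℝ] ℝ where
  toFun f := f.1 x
  map_one' := rfl
  map_mul' _ _ := rfl
  map_zero' := rfl
  map_add' _ _ := rfl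
  commutes' _ := rfl

theorem partialD_apply {d : ℕ} (i : Fin d) (f : SmoothFn d) (x : Fin d → ℝ) :
    (partialD i f).1 x = fderiv ℝ f.1 x (Pi.single i 1) := rfl

theorem partialD_mul {d : ℕ} (i : Fin d) (f g : SmoothFn d) :
    partialD i (f * g) = f * partialD i g + partialD i f * g := by
  refine SmoothFn.ext fun x => ?_
  change fderiv ℝ (f.1 * g.1) x _ = f.1 x * fderiv ℝ g.1 x _ + fderiv ℝ f.1 x _ * g.1 x
  rw [fderiv_mul (f.differentiable x) (g.differentiable x)]
  simp [mul_comm]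

theorem partialD_comm {d : ℕ} (i j : Fin d) (f : SmoothFn d) :
    partialD i (partialD j f) = partialD j (partialD i f) := by
  refine SmoothFn.ext fun x => ?_
  have hd : DifferentiableAt ℝ (fderiv ℝ f.1) x :=
    ((f.contDiff.fderiv_right (m := ∞) (by simp)).differentiable (by simp)) x
  have key : ∀ v w : Fin d → ℝ,
      fderiv ℝ (fun y => fderiv ℝ f.1 y v) x w = fderiv ℝ (fderiv ℝ f.1) x w v := by
    intro v w
    rw [fderiv_clm_apply hd (differentiableAt_const v)]
    simp
  have hs : IsSymmSndFDerivAt ℝ f.1 x :=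
    f.contDiff.contDiffAt.isSymmSndFDerivAt (by
      rw [minSmoothness_of_isRCLikeNormedField]
      exact WithTop.coe_le_coe.2 le_top)
  change fderiv ℝ (fun y => fderiv ℝ f.1 y (Pi.single j 1)) x (Pi.single i 1)
    = fderiv ℝ (fun y => fderiv ℝ f.1 y (Pi.single i 1)) x (Pi.single j 1)
  rw [key, key]
  exact hs _ _

/-! ### Operators on symbols -/

theorem eta_mul_self {d : ℕ} (i : Fin d) : eta i * eta i = 1 := by
  unfold eta; split_ifs <;> norm_num

theorem coeffD_zero {d : ℕ} (i : Fin d) : coeffD i (0 : Symb d) = 0 := by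
  simpa using coeffD_smul i 0 (0 : Symb d)

theorem trace_zero {d : ℕ} : trace (0 : Symb d) = 0 := by
  simpa using trace_smul 0 (0 : Symb d)

theorem pGrad_zero {d : ℕ} : pGrad (0 : Symb d) = 0 := by
  simpa using pGrad_smul 0 (0 : Symb d)

theorem coeffD_sum {d : ℕ} {ι : Type*} (i : Fin d) (s : Finset ι) (f : ι → Symb d) :
    coeffD i (∑ a ∈ s, f a) = ∑ a ∈ s, coeffD i (f a) :=
  map_sum (AddMonoidHom.mk' (coeffD i) (coeffD_add i)) f s

theorem trace_sum {d : ℕ} {ι : Type*} (s : Finset ι) (f : ι → Symb d) :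
    trace (∑ a ∈ s, f a) = ∑ a ∈ s, trace (f a) :=
  map_sum (AddMonoidHom.mk' trace trace_add) f s

theorem trace_sub {d : ℕ} (V W : Symb d) : trace (V - W) = trace V - trace W :=
  map_sub (AddMonoidHom.mk' trace trace_add) V W

theorem pGrad_sub {d : ℕ} (V W : Symb d) : pGrad (V - W) = pGrad V - pGrad W :=
  map_sub (AddMonoidHom.mk' pGrad pGrad_add) V W

theorem coeffD_X_mul {d : ℕ} (i j : Fin d) (V : Symb d) :
    coeffD i (X j * V) = X j * coeffD i V := by
  classical
  ext m : 1
  rw [coeff_coeffD, coeff_X_mul', coeff_X_mul']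
  split_ifs with h
  · rw [coeff_coeffD]
  · rw [map_zero]

theorem coeffD_comm {d : ℕ} (i j : Fin d) (V : Symb d) :
    coeffD i (coeffD j V) = coeffD j (coeffD i V) := by
  ext m : 1
  simp only [coeff_coeffD, partialD_comm i j]

theorem coeffD_pderiv {d : ℕ} (i j : Fin d) (V : Symb d) :
    coeffD i (pderiv j V) = pderiv j (coeffD i V) := by
  ext m : 1
  rw [coeff_coeffD, coeff_pderiv, coeff_pderiv, coeff_coeffD, ← Nat.cast_succ, mul_comm,
    ← nsmul_eq_mul, map_nsmul, nsmul_eq_mul, mul_comm]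

/-- The divergence `∂²/∂x^μ ∂p_μ`. -/
def divergence {d : ℕ} (V : Symb d) : Symb d := ∑ i : Fin d, coeffD i (pderiv i V)

/-- The wave operator acting on the coefficients of a polynomial in `p`. -/
def coeffBox {d : ℕ} (V : Symb d) : Symb d := ∑ i : Fin d, eta i • coeffD i (coeffD i V)

theorem divergence_add {d : ℕ} (V W : Symb d) :
    divergence (V + W) = divergence V + divergence W := by
  simp [divergence, coeffD_add, Finset.sum_add_distrib]

theorem pderiv_real_smul {d : ℕ} (i : Fin d) (c : ℝ) (V : Symb d) :
    pderiv i (c • V) = c • pderiv i V := (pderiv i).map_smul_of_tower c V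

theorem divergence_smul {d : ℕ} (c : ℝ) (V : Symb d) :
    divergence (c • V) = c • divergence V := by
  simp [divergence, coeffD_smul, Finset.smul_sum]

theorem divergence_zero {d : ℕ} : divergence (0 : Symb d) = 0 := by
  simpa using divergence_smul 0 (0 : Symb d)

theorem divergence_sum {d : ℕ} {ι : Type*} (s : Finset ι) (f : ι → Symb d) :
    divergence (∑ a ∈ s, f a) = ∑ a ∈ s, divergence (f a) :=
  map_sum (AddMonoidHom.mk' divergence divergence_add) f s

theorem coeffBox_add {d : ℕ} (V W : Symb d) :
    coeffBox (V + W) = coeffBox V + coeffBox W := by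
  simp [coeffBox, coeffD_add, Finset.sum_add_distrib]

theorem coeffBox_smul {d : ℕ} (c : ℝ) (V : Symb d) :
    coeffBox (c • V) = c • coeffBox V := by
  simp [coeffBox, coeffD_smul, Finset.smul_sum, smul_comm c]

theorem pderiv_X_mul {d : ℕ} (i j : Fin d) (V : Symb d) :
    pderiv i (X j * V) = X j * pderiv i V + if i = j then V else 0 := by
  rw [Derivation.leibniz, pderiv_X, smul_eq_mul, smul_eq_mul, Pi.single_apply]
  by_cases h : i = j
  · subst h; simp
  · simp [h, Ne.symm h]

theorem divergence_X_mul {d : ℕ} (j : Fin d) (V : Symb d) :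
    divergence (X j * V) = X j * divergence V + coeffD j V := by
  unfold divergence
  rw [Finset.mul_sum]
  have : ∀ i : Fin d, coeffD i (pderiv i (X j * V))
      = X j * coeffD i (pderiv i V) + if i = j then coeffD i V else 0 := by
    intro i
    rw [pderiv_X_mul, coeffD_add, coeffD_X_mul]
    split_ifs with h
    · rfl
    · rw [coeffD_zero]
  rw [Finset.sum_congr rfl fun i _ => this i, Finset.sum_add_distrib]
  simp

theorem divergence_coeffD {d : ℕ} (j : Fin d) (V : Symb d) :
    divergence (coeffD j V) = coeffD j (divergence V) := by
  unfold divergence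
  rw [coeffD_sum]
  exact Finset.sum_congr rfl fun i _ => by rw [← coeffD_pderiv, coeffD_comm]

theorem divergence_pGrad {d : ℕ} (V : Symb d) :
    divergence (pGrad V) = pGrad (divergence V) + coeffBox V := by
  unfold pGrad coeffBox
  rw [divergence_sum, ← Finset.sum_add_distrib]
  exact Finset.sum_congr rfl fun i _ => by
    rw [divergence_smul, divergence_X_mul, divergence_coeffD, smul_add]

theorem divergence_coeffBox {d : ℕ} (V : Symb d) :
    divergence (coeffBox V) = coeffBox (divergence V) := by
  unfold coeffBox
  rw [divergence_sum]
  exact Finset.sum_congr rfl fun i _ => by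
    rw [divergence_smul, divergence_coeffD, divergence_coeffD]

theorem divergence_pSq_mul {d : ℕ} (V : Symb d) :
    divergence (pSq d * V) = pSq d * divergence V + (2 : ℝ) • pGrad V := by
  unfold pSq pGrad
  rw [Finset.sum_mul, Finset.sum_mul, divergence_sum, Finset.smul_sum, ← Finset.sum_add_distrib]
  refine Finset.sum_congr rfl fun i _ => ?_
  rw [smul_mul_assoc, mul_assoc, divergence_smul, divergence_X_mul, divergence_X_mul,
    coeffD_X_mul, smul_mul_assoc, smul_comm (2 : ℝ), ← smul_add, two_smul]
  congr 1
  ring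

theorem trace_X_mul {d : ℕ} (j : Fin d) (V : Symb d) :
    trace (X j * V) = X j * trace V + (2 * eta j) • pderiv j V := by
  unfold trace
  rw [Finset.mul_sum]
  have : ∀ i : Fin d, eta i • pderiv i (pderiv i (X j * V))
      = X j * (eta i • pderiv i (pderiv i V))
        + if i = j then (2 * eta i) • pderiv i V else 0 := by
    intro i
    rw [pderiv_X_mul, map_add, pderiv_X_mul]
    split_ifs with h
    · rw [mul_smul_comm, mul_comm 2, mul_smul, two_smul, ← smul_add, add_assoc]
    · rw [map_zero, mul_smul_comm, add_zero, add_zero, add_zero]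
  rw [Finset.sum_congr rfl fun i _ => this i, Finset.sum_add_distrib]
  simp

theorem trace_coeffD {d : ℕ} (j : Fin d) (V : Symb d) :
    trace (coeffD j V) = coeffD j (trace V) := by
  unfold trace
  rw [coeffD_sum]
  exact Finset.sum_congr rfl fun i _ => by
    rw [coeffD_smul, coeffD_pderiv, coeffD_pderiv]

theorem trace_pGrad {d : ℕ} (V : Symb d) :
    trace (pGrad V) = pGrad (trace V) + (2 : ℝ) • divergence V := by
  unfold pGrad divergence
  rw [trace_sum, Finset.smul_sum, ← Finset.sum_add_distrib]
  refine Finset.sum_congr rfl fun i _ => ?_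
  rw [trace_smul, trace_X_mul, trace_coeffD, smul_add, smul_smul, coeffD_pderiv,
    show eta i * (2 * eta i) = 2 by linear_combination 2 * eta_mul_self i]

theorem trace_pderiv {d : ℕ} (j : Fin d) (V : Symb d) :
    trace (pderiv j V) = pderiv j (trace V) := by
  unfold trace
  rw [map_sum]
  refine Finset.sum_congr rfl fun i _ => ?_
  have hc : ∀ W : Symb d, pderiv i (pderiv j W) = pderiv j (pderiv i W) := by
    intro W
    -- Both sides are derivations in `W`, so it suffices that the commutator kills the variables.
    have h := LinearMap.congr_fun (M := Symb d) (congrArg Derivation.toLinearMap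
      (show ⁅(pderiv i : Derivation (SmoothFn d) (Symb d) (Symb d)), pderiv j⁆ = 0 from
        MvPolynomial.derivation_ext fun k => by
          rw [Derivation.commutator_apply]
          simp [pderiv_X, Pi.single_apply]
          split_ifs <;> simp)) W
    exact sub_eq_zero.1
      ((Derivation.commutator_apply (D1 := pderiv i) (D2 := pderiv j) W).symm.trans h)
  rw [pderiv_real_smul, hc, hc]

theorem trace_divergence {d : ℕ} (V : Symb d) :
    trace (divergence V) = divergence (trace V) := by
  unfold divergence
  rw [trace_sum]
  exact Finset.sum_congr rfl fun i _ => by rw [trace_coeffD, trace_pderiv]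

/-- `[η_{μν} ∂²/∂p_μ ∂p_ν, p²] = 4 p·∂_p + 2 d`, with Euler's identity for `p·∂_p`. -/
theorem trace_pSq_mul {d n : ℕ} {V : Symb d} (hV : V.IsHomogeneous n) :
    trace (pSq d * V) = pSq d * trace V + (4 * n + 2 * d : ℝ) • V := by
  have hE := hV.sum_X_mul_pderiv
  have : ∀ i : Fin d, trace ((eta i • (X i * X i)) * V)
      = (eta i • (X i * X i)) * trace V + ((4 : ℝ) • (X i * pderiv i V) + (2 : ℝ) • V) := by
    intro i
    rw [smul_mul_assoc, mul_assoc, trace_smul, trace_X_mul, trace_X_mul, pderiv_X_mul, if_pos rfl,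
      smul_mul_assoc, mul_assoc]
    have e : eta i • (2 * eta i) • (X i * pderiv i V + V)
        = (2 : ℝ) • (X i * pderiv i V + V) := by
      rw [smul_smul, show eta i * (2 * eta i) = 2 by linear_combination 2 * eta_mul_self i]
    have e' : eta i • (X i * ((2 * eta i) • pderiv i V)) = (2 : ℝ) • (X i * pderiv i V) := by
      rw [mul_smul_comm, smul_smul,
        show eta i * (2 * eta i) = 2 by linear_combination 2 * eta_mul_self i]
    rw [smul_add, e, mul_add, smul_add, e']
    module
  unfold pSq
  rw [Finset.sum_mul, Finset.sum_mul, trace_sum]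
  simp only [this]
  rw [Finset.sum_add_distrib, Finset.sum_add_distrib, ← Finset.smul_sum, hE]
  simp only [Finset.sum_const, Finset.card_univ, Fintype.card_fin]
  congr 1
  rw [← Nat.cast_smul_eq_nsmul ℝ n, ← Nat.cast_smul_eq_nsmul ℝ d]
  module

/-! ### Homogeneity and the order filtration -/

theorem IsHomogeneous.real_smul {d n : ℕ} {V : Symb d} (c : ℝ) (hV : V.IsHomogeneous n) :
    (c • V).IsHomogeneous n := by
  rw [← algebraMap_smul (SmoothFn d) c V]
  exact (homogeneousSubmodule (Fin d) (SmoothFn d) n).smul_mem _ hV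

theorem isHomogeneous_coeffD {d n : ℕ} {V : Symb d} (i : Fin d) (hV : V.IsHomogeneous n) :
    (coeffD i V).IsHomogeneous n := by
  intro m hm
  refine hV fun h => hm ?_
  rw [coeff_coeffD, h, map_zero]

theorem isHomogeneous_pSq (d : ℕ) : (pSq d).IsHomogeneous 2 :=
  IsHomogeneous.sum _ _ _ fun i _ =>
    IsHomogeneous.real_smul _ ((isHomogeneous_X _ i).mul (isHomogeneous_X _ i))

theorem isHomogeneous_pGrad {d n : ℕ} {V : Symb d} (hV : V.IsHomogeneous n) :
    (pGrad V).IsHomogeneous (n + 1) :=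
  IsHomogeneous.sum _ _ _ fun i _ => IsHomogeneous.real_smul _ (by
    rw [add_comm]
    exact (isHomogeneous_X _ i).mul (isHomogeneous_coeffD i hV))

theorem isHomogeneous_divergence {d n : ℕ} {V : Symb d} (hV : V.IsHomogeneous n) :
    (divergence V).IsHomogeneous (n - 1) :=
  IsHomogeneous.sum _ _ _ fun i _ => isHomogeneous_coeffD i hV.pderiv

theorem isHomogeneous_trace {d n : ℕ} {V : Symb d} (hV : V.IsHomogeneous n) :
    (trace V).IsHomogeneous (n - 2) :=
  IsHomogeneous.sum _ _ _ fun _ _ => IsHomogeneous.real_smul _ hV.pderiv.pderiv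

theorem pderiv_eq_zero_of_isHomogeneous_zero {d : ℕ} {V : Symb d} (i : Fin d)
    (hV : V.IsHomogeneous 0) : pderiv i V = 0 := by
  rw [← totalDegree_zero_iff_isHomogeneous, totalDegree_eq_zero_iff_eq_C] at hV
  rw [hV, pderiv_C]

theorem trace_eq_zero_of_isHomogeneous {d n : ℕ} {V : Symb d} (hn : n < 2)
    (hV : V.IsHomogeneous n) : trace V = 0 := by
  refine Finset.sum_eq_zero fun i _ => ?_
  have h : (pderiv i V).IsHomogeneous (n - 1) := hV.pderiv
  rw [show n - 1 = 0 by omega] at h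
  rw [pderiv_eq_zero_of_isHomogeneous_zero i h, smul_zero]

theorem divergence_eq_zero_of_isHomogeneous_zero {d : ℕ} {V : Symb d}
    (hV : V.IsHomogeneous 0) : divergence V = 0 :=
  Finset.sum_eq_zero fun i _ => by
    rw [pderiv_eq_zero_of_isHomogeneous_zero i hV, coeffD_zero]

theorem homogeneousComponent_add_two_pSq_mul {d : ℕ} (n : ℕ) (R : Symb d) :
    homogeneousComponent (n + 2) (pSq d * R) = pSq d * homogeneousComponent n R := by
  conv_lhs => rw [← sum_homogeneousComponent R]
  conv_rhs => rw [← sum_homogeneousComponent R]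
  rw [Finset.mul_sum, map_sum, map_sum, Finset.mul_sum]
  refine Finset.sum_congr rfl fun i _ => ?_
  have hi := homogeneousComponent_isHomogeneous i R
  have hp : pSq d * homogeneousComponent i R ∈ homogeneousSubmodule (Fin d) (SmoothFn d) (2 + i) :=
    (isHomogeneous_pSq d).mul hi
  rw [homogeneousComponent_of_mem hp, homogeneousComponent_of_mem (p := homogeneousComponent i R) hi]
  by_cases h : n = i
  · subst h
    rw [if_pos (by omega), if_pos rfl]
  · rw [if_neg (by omega), if_neg h, mul_zero]

theorem homogeneousComponent_pSq_mul_of_lt_two {d : ℕ} {n : ℕ} (hn : n < 2) (R : Symb d) :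
    homogeneousComponent n (pSq d * R) = 0 := by
  rw [← sum_homogeneousComponent R, Finset.mul_sum, map_sum]
  refine Finset.sum_eq_zero fun i _ => ?_
  have hp : pSq d * homogeneousComponent i R ∈ homogeneousSubmodule (Fin d) (SmoothFn d) (2 + i) :=
    (isHomogeneous_pSq d).mul (homogeneousComponent_isHomogeneous i R)
  rw [homogeneousComponent_of_mem hp, if_neg (by omega)]

/-- Symbols of order less than `k`. -/
def symbolsBelow (d k : ℕ) : Submodule (SmoothFn d) (Symb d) where
  carrier := {P | ∀ m : Fin d →₀ ℕ, k ≤ m.degree → P.coeff m = 0}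
  add_mem' hP hQ m hm := by rw [coeff_add, hP m hm, hQ m hm, add_zero]
  zero_mem' _ _ := coeff_zero _
  smul_mem' c P hP m hm := by rw [coeff_smul, hP m hm, smul_zero]

theorem symbolsBelow_mono {d : ℕ} {k l : ℕ} (h : k ≤ l) : symbolsBelow d k ≤ symbolsBelow d l :=
  fun _ hP m hm => hP m (h.trans hm)

theorem symbolsBelow_real_smul {d k : ℕ} {P : Symb d} (c : ℝ) (hP : P ∈ symbolsBelow d k) :
    c • P ∈ symbolsBelow d k := by
  rw [← algebraMap_smul (SmoothFn d) c P]
  exact (symbolsBelow d k).smul_mem _ hP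

theorem eq_zero_of_mem_symbolsBelow_zero {d : ℕ} {P : Symb d} (hP : P ∈ symbolsBelow d 0) :
    P = 0 := by
  ext m : 1
  rw [hP m (Nat.zero_le _), coeff_zero]

theorem mem_symbolsBelow_of_isHomogeneous {d k n : ℕ} {P : Symb d} (hP : P.IsHomogeneous n)
    (h : n < k) : P ∈ symbolsBelow d k := fun _ hm => hP.coeff_eq_zero (by omega)

theorem mem_symbolsBelow_succ_iff {d k : ℕ} {P : Symb d} :
    P ∈ symbolsBelow d (k + 1) ↔ P.totalDegree ≤ k := by
  constructor
  · intro h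
    refine Finset.sup_le fun m hm => ?_
    by_contra hlt
    exact mem_support_iff.1 hm (h m (not_le.1 hlt))
  · intro h m hm
    refine coeff_eq_zero_of_totalDegree_lt (lt_of_le_of_lt h ?_)
    exact hm

theorem exists_mem_symbolsBelow {d : ℕ} (P : Symb d) : ∃ k, P ∈ symbolsBelow d k :=
  ⟨P.totalDegree + 1, mem_symbolsBelow_succ_iff.2 le_rfl⟩

theorem X_mul_mem_symbolsBelow {d k : ℕ} {P : Symb d} (i : Fin d) (hP : P ∈ symbolsBelow d k) :
    X i * P ∈ symbolsBelow d (k + 1) := by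
  classical
  intro m hm
  rw [coeff_X_mul']
  split_ifs with h
  · refine hP _ ?_
    have hle : Finsupp.single i 1 ≤ m := by
      simpa [Finsupp.single_le_iff, Nat.one_le_iff_ne_zero] using h
    have e : (m - Finsupp.single i 1).degree + 1 = m.degree := by
      conv_rhs => rw [← tsub_add_cancel_of_le hle]
      rw [map_add, Finsupp.degree_single]
    omega
  · rfl

theorem coeffD_mem_symbolsBelow {d k : ℕ} {P : Symb d} (i : Fin d) (hP : P ∈ symbolsBelow d k) :
    coeffD i P ∈ symbolsBelow d k := fun m hm => by
  rw [coeff_coeffD, hP m hm, map_zero]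

theorem pSq_mul_mem_symbolsBelow {d k : ℕ} {P : Symb d} (hP : P ∈ symbolsBelow d k) :
    pSq d * P ∈ symbolsBelow d (k + 2) := by
  unfold pSq
  rw [Finset.sum_mul]
  refine Submodule.sum_mem _ fun i _ => ?_
  rw [smul_mul_assoc, mul_assoc]
  exact symbolsBelow_real_smul _ (X_mul_mem_symbolsBelow i (X_mul_mem_symbolsBelow i hP))

theorem pGrad_mem_symbolsBelow {d k : ℕ} {P : Symb d} (hP : P ∈ symbolsBelow d k) :
    pGrad P ∈ symbolsBelow d (k + 1) :=
  Submodule.sum_mem _ fun i _ =>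
    symbolsBelow_real_smul _ (X_mul_mem_symbolsBelow i (coeffD_mem_symbolsBelow i hP))

theorem coeffBox_mem_symbolsBelow {d k : ℕ} {P : Symb d} (hP : P ∈ symbolsBelow d k) :
    coeffBox P ∈ symbolsBelow d k :=
  Submodule.sum_mem _ fun i _ =>
    symbolsBelow_real_smul _ (coeffD_mem_symbolsBelow i (coeffD_mem_symbolsBelow i hP))

theorem homogeneousComponent_eq_zero_of_mem_symbolsBelow {d k : ℕ} {P : Symb d}
    (hP : P ∈ symbolsBelow d k) : homogeneousComponent k P = 0 := by
  classical
  ext m : 1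
  rw [coeff_homogeneousComponent, coeff_zero]
  split_ifs with h
  · exact hP m h.ge
  · rfl

theorem sub_homogeneousComponent_mem_symbolsBelow {d k : ℕ} {P : Symb d}
    (hP : P ∈ symbolsBelow d (k + 1)) : P - homogeneousComponent k P ∈ symbolsBelow d k := by
  classical
  intro m hm
  rw [coeff_sub, coeff_homogeneousComponent]
  split_ifs with h
  · rw [sub_self]
  · rw [hP m (by omega), sub_zero]

theorem homogeneousComponent_eq_of_sub_mem {d k : ℕ} {P V : Symb d} (hV : V.IsHomogeneous k)
    (h : P - V ∈ symbolsBelow d k) : homogeneousComponent k P = V := by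
  have := homogeneousComponent_eq_zero_of_mem_symbolsBelow h
  rwa [map_sub, homogeneousComponent_eq_self hV, sub_eq_zero] at this

/-- Symbols have coefficients in a ring with zero divisors, but their values at each point of `ℝ^d`
are polynomials over a field, where total degrees add. -/
theorem mem_symbolsBelow_of_pSq_mul {d k : ℕ} (hd : 0 < d) {P : Symb d}
    (h : pSq d * P ∈ symbolsBelow d (k + 2)) : P ∈ symbolsBelow d k := by
  intro m hm
  refine SmoothFn.ext fun x => ?_
  change evalAt x (P.coeff m) = 0
  have hc : evalAt x (P.coeff m) = (map (evalAt x).toRingHom P).coeff m :=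
    (coeff_map (evalAt x).toRingHom P m).symm
  rw [hc]
  set q := map (evalAt x).toRingHom P with hq
  set s := map (evalAt x).toRingHom (pSq d) with hs
  by_contra hne
  have hq0 : q ≠ 0 := fun h0 => hne (by rw [h0, coeff_zero])
  have hscoeff : s.coeff (Finsupp.single ⟨0, hd⟩ 2) = -1 := by
    classical
    rw [hs, coeff_map, pSq, coeff_sum]
    have e : ∀ i : Fin d, coeff (Finsupp.single (⟨0, hd⟩ : Fin d) 2)
        (eta i • (X i * X i : Symb d)) = if i = ⟨0, hd⟩ then algebraMap ℝ _ (-1) else 0 := by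
      intro i
      rw [coeff_smul, ← sq, X_pow_eq_monomial, coeff_monomial]
      by_cases hi : i = ⟨0, hd⟩
      · subst hi
        simp [eta, Algebra.algebraMap_eq_smul_one]
      · rw [if_neg, if_neg hi, smul_zero]
        intro hh
        exact hi (Finsupp.single_left_injective (by norm_num) hh)
    rw [Finset.sum_congr rfl fun i _ => e i, Finset.sum_ite_eq' , if_pos (Finset.mem_univ _)]
    exact (evalAt x).commutes (-1)
  have hs0 : s ≠ 0 := fun h0 => by rw [h0, coeff_zero] at hscoeff; norm_num at hscoeff
  have hsdeg : 2 ≤ s.totalDegree := by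
    have := le_totalDegree (p := s) (s := Finsupp.single ⟨0, hd⟩ 2)
      (mem_support_iff.2 (by rw [hscoeff]; norm_num))
    simpa using this
  have hqdeg : k ≤ q.totalDegree := by
    have := le_totalDegree (p := q) (s := m) (mem_support_iff.2 hne)
    exact hm.trans this
  have hmul : (s * q).totalDegree ≤ k + 1 := by
    rw [hs, hq, ← map_mul]
    exact (Finset.sup_mono (support_map_subset _ _)).trans (mem_symbolsBelow_succ_iff.1 h)
  rw [totalDegree_mul_of_isDomain hs0 hq0] at hmul
  omega

theorem pSq_mul_cancel {d : ℕ} (hd : 0 < d) {P Q : Symb d} (h : pSq d * P = pSq d * Q) :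
    P = Q := by
  refine sub_eq_zero.1 (eq_zero_of_mem_symbolsBelow_zero (mem_symbolsBelow_of_pSq_mul hd ?_))
  rw [mul_sub, h, sub_self]
  exact Submodule.zero_mem _

/-- A homogeneous symbol that is a multiple of `p²` up to lower order is a multiple of `p²`. -/
theorem exists_eq_pSq_mul {d k : ℕ} {V R : Symb d} (hV : V.IsHomogeneous k)
    (h : V - pSq d * R ∈ symbolsBelow d k) : ∃ Q, Q.IsHomogeneous (k - 2) ∧ V = pSq d * Q := by
  have h0 := homogeneousComponent_eq_zero_of_mem_symbolsBelow h
  rw [map_sub, homogeneousComponent_eq_self hV, sub_eq_zero] at h0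
  rcases lt_or_ge k 2 with hk | hk
  · exact ⟨0, isHomogeneous_zero _ _ _, by
      rw [h0, homogeneousComponent_pSq_mul_of_lt_two hk, mul_zero]⟩
  · obtain ⟨n, rfl⟩ := Nat.exists_eq_add_of_le' hk
    exact ⟨homogeneousComponent n R, homogeneousComponent_isHomogeneous n R, by
      rw [h0, homogeneousComponent_add_two_pSq_mul]⟩

/-! ### Harmonic decomposition -/

/-- `p² ∘ trace + c` is injective on homogeneous symbols for `c > 0`. -/
theorem eq_zero_of_pSq_mul_trace_add_smul {d : ℕ} (n : ℕ) : ∀ (c : ℝ) (_ : 0 < c) (U : Symb d)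
    (_ : U.IsHomogeneous n) (_ : pSq d * trace U + c • U = 0), U = 0 := by
  induction n using Nat.strong_induction_on with
  | _ n ih =>
    intro c hc U hU h
    have hT : trace U = 0 := by
      -- The trace of the equation has the same form for `trace U`, with a larger constant.
      rcases lt_or_ge n 2 with hn | hn
      · exact trace_eq_zero_of_isHomogeneous hn hU
      · have h2 := congrArg trace h
        rw [trace_add, trace_pSq_mul (isHomogeneous_trace hU), trace_smul, trace_zero, add_assoc,
          ← add_smul] at h2
        exact ih (n - 2) (by omega) _ (by positivity) _ (isHomogeneous_trace hU) h2
    rw [hT, mul_zero, zero_add] at h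
    exact (smul_eq_zero.1 h).resolve_left hc.ne'

/-- `p² ∘ trace + c` is surjective on homogeneous symbols for `c > 0`. -/
theorem exists_pSq_mul_trace_add_smul {d : ℕ} (n : ℕ) : ∀ (c : ℝ) (_ : 0 < c) (P : Symb d)
    (_ : P.IsHomogeneous n), ∃ Q : Symb d, Q.IsHomogeneous n ∧ pSq d * trace Q + c • Q = P := by
  induction n using Nat.strong_induction_on with
  | _ n ih =>
    intro c hc P hP
    rcases lt_or_ge n 2 with hn | hn
    · have hQ : (c⁻¹ • P).IsHomogeneous n := IsHomogeneous.real_smul _ hP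
      exact ⟨c⁻¹ • P, hQ, by
        rw [trace_eq_zero_of_isHomogeneous hn hQ, mul_zero, zero_add, smul_inv_smul₀ hc.ne']⟩
    -- The trace of the equation for `Q` is an equation of the same form for `trace Q`.
    · obtain ⟨R, hR, e⟩ := ih (n - 2) (by omega) (4 * ((n - 2 : ℕ) : ℝ) + 2 * d + c)
        (by positivity) (trace P) (isHomogeneous_trace hP)
      have hpR : (pSq d * R).IsHomogeneous n := by
        have := (isHomogeneous_pSq d).mul hR
        rwa [show 2 + (n - 2) = n by omega] at this
      -- `R` is the trace of the solution `Q = (P - p² R) / c`.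
      have hQ : trace (c⁻¹ • (P - pSq d * R)) = R := by
        rw [trace_smul, trace_sub, trace_pSq_mul hR, ← e, add_smul _ c]
        rw [show ∀ a b r : Symb d, a + (b + r) - (a + b) = r from fun a b r => by ring,
          inv_smul_smul₀ hc.ne']
      exact ⟨c⁻¹ • (P - pSq d * R), IsHomogeneous.real_smul _ (hP.sub hpR), by
        rw [hQ, smul_inv_smul₀ hc.ne']; ring⟩

/-- Every homogeneous symbol is a trace-free one plus a multiple of `p²`: the multiple `p² Q` has the
same trace as `P` when `(p² ∘ trace + 4 (n - 2) + 2 d) Q = trace P`. -/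
theorem exists_trace_free_add_pSq_mul {d n : ℕ} (hd : 0 < d) {P : Symb d} (hP : P.IsHomogeneous n) :
    ∃ V Q : Symb d, V.IsHomogeneous n ∧ trace V = 0 ∧ P = V + pSq d * Q ∧
      (pSq d * Q).IsHomogeneous n ∧ Q ∈ symbolsBelow d (n - 1) := by
  rcases lt_or_ge n 2 with hn | hn
  · exact ⟨P, 0, hP, trace_eq_zero_of_isHomogeneous hn hP, by simp, by
      rw [mul_zero]; exact isHomogeneous_zero _ _ _, Submodule.zero_mem _⟩
  · have hd' : (0 : ℝ) < d := by exact_mod_cast hd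
    obtain ⟨Q, hQ, e⟩ := exists_pSq_mul_trace_add_smul (n - 2) (4 * ((n - 2 : ℕ) : ℝ) + 2 * d)
      (by positivity) (trace P) (isHomogeneous_trace hP)
    have hpQ : (pSq d * Q).IsHomogeneous n := by
      have := (isHomogeneous_pSq d).mul hQ
      rwa [show 2 + (n - 2) = n by omega] at this
    exact ⟨P - pSq d * Q, Q, hP.sub hpQ, by
      rw [trace_sub, trace_pSq_mul hQ, e, sub_self], by ring, hpQ,
      mem_symbolsBelow_of_isHomogeneous hQ (by omega)⟩

/-- The sum in the harmonic decomposition is direct. -/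
theorem eq_zero_of_trace_eq_zero_of_eq_pSq_mul {d n : ℕ} (hd : 0 < d) {V Q : Symb d}
    (hQ : Q.IsHomogeneous n) (hV : trace V = 0) (h : V = pSq d * Q) : V = 0 := by
  have hd' : (0 : ℝ) < d := by exact_mod_cast hd
  rw [h, trace_pSq_mul hQ] at hV
  rw [h, eq_zero_of_pSq_mul_trace_add_smul n _ (by positivity) Q hQ hV, mul_zero]

/-! ### Symmetries from conformal Killing tensors -/

/-- The trace of `p·∂_x V = p² W` determines `W` as a multiple of the divergence of `V`. -/
theorem pGrad_eq_pSq_mul_divergence {d n : ℕ} (hd : 0 < d) {V : Symb d}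
    (hV : V.IsHomogeneous (n + 1)) (ht : trace V = 0) (hG : ∃ W : Symb d, pGrad V = pSq d * W) :
    (d + 2 * n : ℝ) • pGrad V = pSq d * divergence V := by
  have hd' : (0 : ℝ) < d := by exact_mod_cast hd
  obtain ⟨W₀, h₀⟩ := hG
  obtain ⟨W, hW, e⟩ := exists_eq_pSq_mul (R := W₀) (isHomogeneous_pGrad hV)
    (by rw [h₀, sub_self]; exact Submodule.zero_mem _)
  replace hW : W.IsHomogeneous n := hW
  have h1 : (2 : ℝ) • divergence V = pSq d * trace W + (4 * n + 2 * d : ℝ) • W := by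
    rw [← trace_pSq_mul hW, ← e, trace_pGrad, ht, pGrad_zero, zero_add]
  -- The double trace of `p·∂_x V` vanishes, so `W` is trace-free.
  have h2 : trace W = 0 := by
    have h3 := congrArg trace h1
    rw [trace_smul, trace_divergence, ht, divergence_zero, smul_zero, trace_add,
      trace_pSq_mul (isHomogeneous_trace hW), trace_smul, add_assoc, ← add_smul] at h3
    exact eq_zero_of_pSq_mul_trace_add_smul _ _ (by positivity) _ (isHomogeneous_trace hW) h3.symm
  rw [h2, mul_zero, zero_add] at h1
  rw [e, ← mul_smul_comm]
  congr 1
  have h4 := congrArg (fun U : Symb d => (2⁻¹ : ℝ) • U) h1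
  simp only [smul_smul] at h4
  rw [show (2⁻¹ * 2 : ℝ) = 1 by norm_num, one_smul] at h4
  rw [h4]
  congr 1
  ring

/-- Iterated divergences of a conformal Killing tensor satisfy the conformal Killing equation up to
the wave operator of the previous divergence. -/
theorem pGrad_iterate_divergence {d : ℕ} {N : ℝ} {V : Symb d}
    (h : N • pGrad V = pSq d * divergence V) (j : ℕ) :
    (N - 2 * (j + 1)) • pGrad (divergence^[j + 1] V)
      + ((j + 1) * (N - j)) • coeffBox (divergence^[j] V) = pSq d * divergence^[j + 2] V := by
  induction j with
  | zero =>
    have h1 := congrArg divergence h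
    rw [divergence_smul, divergence_pGrad, divergence_pSq_mul] at h1
    simp only [Function.iterate_succ_apply', Function.iterate_zero_apply, Nat.cast_zero]
    rw [← sub_eq_zero] at h1 ⊢
    rw [← h1]
    module
  | succ j ih =>
    have h1 := congrArg divergence ih
    rw [divergence_add, divergence_smul, divergence_smul, divergence_pGrad, divergence_coeffBox,
      divergence_pSq_mul] at h1
    simp only [← Function.iterate_succ_apply' divergence] at h1
    rw [← sub_eq_zero] at h1 ⊢
    rw [← h1]
    push_cast
    module

/-- A conformal Killing tensor `V` corrected by multiples of its iterated divergences is the symbol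
of a symmetry of the wave equation. -/
theorem exists_symbol_of_conformalKilling {d n : ℕ} (hd : 3 ≤ d) {V : Symb d}
    (hV : V.IsHomogeneous (n + 1)) (ht : trace V = 0) (hG : ∃ W : Symb d, pGrad V = pSq d * W) :
    ∃ A W : Symb d, A - V ∈ symbolsBelow d (n + 1) ∧
      (2 : ℝ) • pGrad A + coeffBox A = pSq d * W := by
  have hd' : (3 : ℝ) ≤ d := by exact_mod_cast hd
  set N : ℝ := d + 2 * n with hN
  have hrel := pGrad_iterate_divergence (pGrad_eq_pSq_mul_divergence (by omega) hV ht hG)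
  rw [← hN] at hrel
  have hhom : ∀ j, (divergence^[j] V).IsHomogeneous (n + 1 - j) := by
    intro j
    induction j with
    | zero => exact hV
    | succ j ih =>
      rw [Function.iterate_succ_apply', ← Nat.sub_sub]
      exact isHomogeneous_divergence ih
  have key : ∀ m ≤ n + 2, ∃ (A W : Symb d) (c : ℝ), A - V ∈ symbolsBelow d (n + 1) ∧
      (2 : ℝ) • pGrad A + coeffBox A = pSq d * W + c • coeffBox (divergence^[m] V) := by
    intro m
    induction m with
    | zero =>
      obtain ⟨W, hW⟩ := hG
      exact fun _ => ⟨V, (2 : ℝ) • W, 1, by rw [sub_self]; exact Submodule.zero_mem _, by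
        rw [hW, one_smul, mul_smul_comm]; rfl⟩
    | succ m ih =>
      intro hm
      obtain ⟨A, W, c, hA, e⟩ := ih (by omega)
      have hm' : (m : ℝ) ≤ n + 1 := by exact_mod_cast (by omega : m ≤ n + 1)
      have hNm : 0 < N - m := by
        have : (0 : ℝ) ≤ n := n.cast_nonneg
        rw [hN]; linarith
      have hb : ((m : ℝ) + 1) * (N - m) ≠ 0 := by positivity
      set b : ℝ := (m + 1) * (N - m) with hbdef
      -- With this `t`, the term `2 t p·∂_x Div^{m+1} V` cancels `c □_x Div^m V` modulo `p²`, at the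
      -- price of `t □_x Div^{m+1} V`.
      set t : ℝ := c / b * (N - 2 * (m + 1)) / 2 with ht'
      refine ⟨A + t • divergence^[m + 1] V, W + (c / b) • divergence^[m + 2] V, t, ?_, ?_⟩
      · rw [add_sub_right_comm]
        exact Submodule.add_mem _ hA (symbolsBelow_real_smul _
          (mem_symbolsBelow_of_isHomogeneous (hhom _) (by omega)))
      · have hr := hrel m
        rw [← hbdef] at hr
        have e2 : (2 * t) • pGrad (divergence^[m + 1] V) = (c / b) • (pSq d * divergence^[m + 2] V)
            - c • coeffBox (divergence^[m] V) := by
          rw [← hr, smul_add, smul_smul, smul_smul, div_mul_cancel₀ c hb,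
            show 2 * t = c / b * (N - 2 * (m + 1)) by rw [ht']; ring]
          abel
        rw [pGrad_add, coeffBox_add, pGrad_smul, coeffBox_smul, smul_add, smul_smul, e2, mul_add,
          mul_smul_comm]
        linear_combination e
  obtain ⟨A, W, c, hA, e⟩ := key (n + 2) le_rfl
  refine ⟨A, W, hA, ?_⟩
  have h0 : (divergence^[n + 1] V).IsHomogeneous 0 := by simpa using hhom (n + 1)
  rw [e, Function.iterate_succ_apply', divergence_eq_zero_of_isHomogeneous_zero h0]
  have hz : coeffBox (0 : Symb d) = 0 := by simpa using coeffBox_smul 0 (0 : Symb d)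
  rw [hz, smul_zero, add_zero]

/-! ### Differential operators and their total symbols -/

theorem DiffOp.mul_apply {d : ℕ} (A B : DiffOp d) (f : SmoothFn d) :
    (A * B).1 f = A.1 (B.1 f) := rfl

theorem DiffOp.add_apply {d : ℕ} (A B : DiffOp d) (f : SmoothFn d) :
    (A + B).1 f = A.1 f + B.1 f := rfl

theorem DiffOp.smul_apply {d : ℕ} (c : ℝ) (A : DiffOp d) (f : SmoothFn d) :
    (c • A).1 f = c • A.1 f := rfl

theorem commute_partialD {d : ℕ} (i j : Fin d) : Commute (partialD (d := d) i) (partialD j) :=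
  LinearMap.ext fun f => partialD_comm i j f

theorem partialD_mul_mulOp {d : ℕ} (i : Fin d) (a : SmoothFn d) :
    partialD i * mulOp a = mulOp a * partialD i + mulOp (partialD i a) :=
  LinearMap.ext fun f => partialD_mul i a f

theorem commute_partialD_multiD {d : ℕ} (i : Fin d) (m : Fin d →₀ ℕ) :
    Commute (partialD i) (multiD m) := by
  refine Commute.list_prod_right _ _ fun y hy => ?_
  obtain ⟨j, -, rfl⟩ := List.mem_map.1 hy
  exact (commute_partialD i j).pow_right _

theorem multiD_zero {d : ℕ} : multiD (0 : Fin d →₀ ℕ) = 1 := by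
  simp [multiD]

theorem multiD_add_single {d : ℕ} (m : Fin d →₀ ℕ) (i : Fin d) :
    multiD (m + Finsupp.single i 1) = multiD m * partialD i := by
  classical
  have key : ∀ l : List (Fin d), l.Nodup →
      (l.map fun j => partialD (d := d) j ^ (m + Finsupp.single i 1 : Fin d →₀ ℕ) j).prod
        = (l.map fun j => partialD j ^ m j).prod * (if i ∈ l then partialD i else 1) := by
    intro l
    induction l with
    | nil => simp
    | cons j l ih =>
      intro hl
      rw [List.nodup_cons] at hl
      rw [List.map_cons, List.map_cons, List.prod_cons, List.prod_cons, ih hl.2]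
      by_cases h : i = j
      · subst h
        have hc : Commute (partialD i) (l.map fun j => partialD (d := d) j ^ m j).prod := by
          refine Commute.list_prod_right _ _ fun y hy => ?_
          obtain ⟨j, -, rfl⟩ := List.mem_map.1 hy
          exact (commute_partialD i j).pow_right _
        rw [if_neg hl.1, if_pos (List.mem_cons_self), mul_one, Finsupp.add_apply,
          Finsupp.single_eq_same, pow_succ, mul_assoc, hc.eq, mul_assoc]
      · have h0 : (Finsupp.single i 1 : Fin d →₀ ℕ) j = 0 := Finsupp.single_eq_of_ne (Ne.symm h)
        rw [Finsupp.add_apply, h0, add_zero, ← mul_assoc]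
        simp [h]
  unfold multiD
  rw [key _ (List.nodup_finRange d), if_pos (List.mem_finRange i)]

theorem symbolOp_eq_sum {d : ℕ} (P : Symb d) {s : Finset (Fin d →₀ ℕ)} (hs : P.support ⊆ s) :
    symbolOp P = ∑ m ∈ s, mulOp (P.coeff m) * multiD m :=
  Finset.sum_subset hs fun m _ hm => by
    rw [notMem_support_iff.1 hm]
    simp [mulOp]

theorem mulOp_add {d : ℕ} (a b : SmoothFn d) : mulOp (a + b) = mulOp a + mulOp b :=
  LinearMap.ext fun f => add_mul a b f

theorem symbolOp_add {d : ℕ} (P Q : Symb d) : symbolOp (P + Q) = symbolOp P + symbolOp Q := by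
  classical
  rw [symbolOp_eq_sum (P + Q) support_add, symbolOp_eq_sum P Finset.subset_union_left,
    symbolOp_eq_sum Q Finset.subset_union_right, ← Finset.sum_add_distrib]
  exact Finset.sum_congr rfl fun m _ => by rw [coeff_add, mulOp_add, add_mul]

theorem symbolOp_smul {d : ℕ} (c : ℝ) (P : Symb d) : symbolOp (c • P) = c • symbolOp P := by
  rw [symbolOp_eq_sum (c • P) (support_smul (a := c)), symbolOp, Finset.smul_sum]
  refine Finset.sum_congr rfl fun m _ => ?_
  rw [coeff_smul, ← smul_mul_assoc]
  congr 1
  exact LinearMap.ext fun f => smul_mul_assoc c _ f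

theorem symbolOp_monomial {d : ℕ} (m : Fin d →₀ ℕ) (a : SmoothFn d) :
    symbolOp (monomial m a) = mulOp a * multiD m := by
  classical
  rw [symbolOp_eq_sum _ support_monomial_subset, Finset.sum_singleton, coeff_monomial, if_pos rfl]

theorem symbolOp_C {d : ℕ} (a : SmoothFn d) : symbolOp (C a) = mulOp a := by
  rw [C_apply, symbolOp_monomial, multiD_zero, mul_one]

theorem symbolOp_C_mul {d : ℕ} (a : SmoothFn d) (P : Symb d) :
    symbolOp (C a * P) = mulOp a * symbolOp P := by
  induction P using MvPolynomial.induction_on' with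
  | monomial m b =>
    rw [C_mul_monomial, symbolOp_monomial, symbolOp_monomial, ← mul_assoc]
    congr 1
    exact LinearMap.ext fun f => mul_assoc a b f
  | add P Q hP hQ => rw [mul_add, symbolOp_add, symbolOp_add, mul_add, hP, hQ]

theorem symbolOp_mul_X {d : ℕ} (i : Fin d) (P : Symb d) :
    symbolOp (P * X i) = symbolOp P * partialD i := by
  induction P using MvPolynomial.induction_on' with
  | monomial m a =>
    rw [X, monomial_mul, mul_one, symbolOp_monomial, symbolOp_monomial, multiD_add_single,
      mul_assoc]
  | add P Q hP hQ => rw [add_mul, symbolOp_add, symbolOp_add, add_mul, hP, hQ]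

theorem coeffD_monomial {d : ℕ} (i : Fin d) (m : Fin d →₀ ℕ) (a : SmoothFn d) :
    coeffD i (monomial m a) = monomial m (partialD i a) := by
  classical
  ext n : 1
  rw [coeff_coeffD, coeff_monomial, coeff_monomial]
  split_ifs
  · rfl
  · rw [map_zero]

/-- The Leibniz rule. -/
theorem partialD_mul_symbolOp {d : ℕ} (i : Fin d) (P : Symb d) :
    partialD i * symbolOp P = symbolOp (X i * P + coeffD i P) := by
  rw [mul_comm (X i), symbolOp_add, symbolOp_mul_X]
  induction P using MvPolynomial.induction_on' with
  | monomial m a =>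
    rw [coeffD_monomial, symbolOp_monomial, symbolOp_monomial, ← mul_assoc, partialD_mul_mulOp,
      add_mul, mul_assoc, mul_assoc, (commute_partialD_multiD i m).eq]
  | add P Q hP hQ =>
    rw [coeffD_add, symbolOp_add, symbolOp_add, mul_add, hP, hQ, add_mul]
    abel

theorem symbolOp_mem {d : ℕ} (P : Symb d) : symbolOp P ∈ diffOpSubalgebra d := by
  unfold symbolOp
  refine sum_mem fun m _ => mul_mem ?_ ?_
  · exact Algebra.subset_adjoin (Or.inl ⟨_, rfl⟩)
  · refine list_prod_mem fun y hy => ?_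
    obtain ⟨j, -, rfl⟩ := List.mem_map.1 hy
    exact pow_mem (partialOp j).2 _

/-- Normal ordering `P(x,p) ↦ P(x,∂)`, from symbols to differential operators. -/
def normalOrder {d : ℕ} : Symb d →ₗ[ℝ] DiffOp d where
  toFun P := ⟨symbolOp P, symbolOp_mem P⟩
  map_add' P Q := Subtype.ext (symbolOp_add P Q)
  map_smul' c P := Subtype.ext (symbolOp_smul c P)

theorem normalOrder_val {d : ℕ} (P : Symb d) : (normalOrder P).1 = symbolOp P := rfl

theorem eq_normalOrder {d : ℕ} {A : DiffOp d} {P : Symb d} (h : A.1 = symbolOp P) :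
    A = normalOrder P := Subtype.ext h

theorem normalOrder_mul_X {d : ℕ} (i : Fin d) (P : Symb d) :
    normalOrder (P * X i) = normalOrder P * partialOp i := Subtype.ext (symbolOp_mul_X i P)

theorem partialOp_mul_normalOrder {d : ℕ} (i : Fin d) (P : Symb d) :
    partialOp i * normalOrder P = normalOrder (X i * P + coeffD i P) :=
  Subtype.ext (partialD_mul_symbolOp i P)

theorem normalOrder_one {d : ℕ} : normalOrder (1 : Symb d) = 1 := by
  refine Subtype.ext ?_
  change symbolOp (1 : Symb d) = 1
  rw [← C_1, symbolOp_C]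
  exact LinearMap.ext fun f => one_mul f

/-- Every differential operator has a total symbol: by the Leibniz rule, operators of the form
`P(x,∂)` are stable under composition with the generators. -/
theorem normalOrder_surjective {d : ℕ} (A : DiffOp d) : ∃ P, A = normalOrder P := by
  obtain ⟨A, hA⟩ := A
  have key : ∀ P : Symb d, ∃ Q, A * symbolOp P = symbolOp Q := by
    unfold diffOpSubalgebra at hA
    induction hA using Algebra.adjoin_induction with
    | mem A hA =>
      intro P
      rcases hA with ⟨a, rfl⟩ | ⟨i, rfl⟩
      · exact ⟨C a * P, (symbolOp_C_mul a P).symm⟩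
      · exact ⟨_, partialD_mul_symbolOp i P⟩
    | algebraMap r => exact fun P => ⟨r • P, by rw [symbolOp_smul, ← Algebra.smul_def]⟩
    | add A B _ _ hA hB =>
      intro P
      obtain ⟨Q, hQ⟩ := hA P
      obtain ⟨R, hR⟩ := hB P
      exact ⟨Q + R, by rw [add_mul, hQ, hR, symbolOp_add]⟩
    | mul A B _ _ hA hB =>
      intro P
      obtain ⟨Q, hQ⟩ := hB P
      obtain ⟨R, hR⟩ := hA Q
      exact ⟨R, by rw [mul_assoc, hQ, hR]⟩
  obtain ⟨Q, hQ⟩ := key 1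
  have h1 : symbolOp (1 : Symb d) = 1 := congrArg Subtype.val (normalOrder_one (d := d))
  rw [h1, mul_one] at hQ
  exact ⟨Q, Subtype.ext hQ⟩

theorem normalOrder_mul_box {d : ℕ} (P : Symb d) :
    normalOrder P * box d = normalOrder (pSq d * P) := by
  unfold box pSq
  rw [Finset.mul_sum, Finset.sum_mul, map_sum]
  refine Finset.sum_congr rfl fun i _ => ?_
  rw [mul_smul_comm, smul_mul_assoc, map_smul, ← mul_assoc, ← normalOrder_mul_X,
    ← normalOrder_mul_X, mul_assoc P, mul_comm P]

theorem box_mul_normalOrder {d : ℕ} (P : Symb d) :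
    box d * normalOrder P = normalOrder (pSq d * P + ((2 : ℝ) • pGrad P + coeffBox P)) := by
  unfold box pSq pGrad coeffBox
  rw [Finset.sum_mul, Finset.sum_mul, Finset.smul_sum, ← Finset.sum_add_distrib,
    ← Finset.sum_add_distrib, map_sum]
  refine Finset.sum_congr rfl fun i _ => ?_
  rw [smul_mul_assoc, mul_assoc, partialOp_mul_normalOrder, partialOp_mul_normalOrder,
    smul_mul_assoc, smul_comm (2 : ℝ), ← smul_add, ← smul_add, map_smul, coeffD_add, coeffD_X_mul]
  congr 2
  rw [two_smul]
  ring

/-- The plane wave `exp(ξ·x)`. -/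
def expWave {d : ℕ} (ξ : Fin d → ℝ) : SmoothFn d :=
  ⟨fun x => Real.exp (∑ i, ξ i * x i),
    show ContDiff ℝ ∞ fun x : Fin d → ℝ => Real.exp (∑ i, ξ i * x i) from
      (ContDiff.sum fun i _ => contDiff_const.mul (contDiff_apply ℝ ℝ i)).exp⟩

theorem partialD_expWave {d : ℕ} (ξ : Fin d → ℝ) (i : Fin d) :
    partialD i (expWave ξ) = ξ i • expWave ξ := by
  refine SmoothFn.ext fun x => ?_
  change fderiv ℝ (fun x : Fin d → ℝ => Real.exp (∑ i, ξ i * x i)) x (Pi.single i 1)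
    = ξ i * Real.exp (∑ i, ξ i * x i)
  have h : HasFDerivAt (fun x : Fin d → ℝ => ∑ i, ξ i * x i)
      (∑ i, ξ i • (ContinuousLinearMap.proj i : (Fin d → ℝ) →L[ℝ] ℝ)) x :=
    HasFDerivAt.fun_sum fun i _ =>
      (ContinuousLinearMap.proj (R := ℝ) (φ := fun _ : Fin d => ℝ) i).hasFDerivAt.const_mul (ξ i)
  rw [h.exp.fderiv]
  simp [Pi.single_apply, mul_comm]

theorem multiD_expWave {d : ℕ} (ξ : Fin d → ℝ) (m : Fin d →₀ ℕ) :
    multiD m (expWave ξ) = (∏ i, ξ i ^ m i) • expWave ξ := by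
  have hpow : ∀ (i : Fin d) (n : ℕ), (partialD i ^ n) (expWave ξ) = ξ i ^ n • expWave ξ := by
    intro i n
    induction n with
    | zero => simp
    | succ n ih =>
      rw [pow_succ, Module.End.mul_apply, partialD_expWave, map_smul, ih, smul_smul, pow_succ,
        mul_comm]
  have key : ∀ l : List (Fin d), (l.map fun i => partialD i ^ m i).prod (expWave ξ)
      = (l.map fun i => ξ i ^ m i).prod • expWave ξ := by
    intro l
    induction l with
    | nil => simp
    | cons i l ih =>
      rw [List.map_cons, List.map_cons, List.prod_cons, List.prod_cons, Module.End.mul_apply, ih,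
        map_smul, hpow, smul_smul, mul_comm]
  unfold multiD
  rw [key, ← List.ofFn_eq_map, List.prod_ofFn]

theorem symbolOp_expWave {d : ℕ} (P : Symb d) (ξ x : Fin d → ℝ) :
    (symbolOp P (expWave ξ)).1 x
      = eval ξ (map (evalAt x).toRingHom P) * Real.exp (∑ i, ξ i * x i) := by
  induction P using MvPolynomial.induction_on' with
  | monomial m a =>
    rw [symbolOp_monomial, map_monomial, eval_monomial, Module.End.mul_apply, multiD_expWave,
      Finsupp.prod_fintype _ _ fun _ => pow_zero _]
    exact (mul_assoc _ _ _).symm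
  | add P Q hP hQ =>
    rw [symbolOp_add, map_add, map_add, add_mul, ← hP, ← hQ]
    rfl

/-- The value of `P(x,∂) exp(ξ·x)` at `x` is `P(x,ξ) exp(ξ·x)`, so plane waves detect the symbol. -/
theorem eq_zero_of_symbolOp_expWave {d : ℕ} {P : Symb d}
    (h : ∀ ξ x, (symbolOp P (expWave ξ)).1 x = 0) : P = 0 := by
  ext m : 1
  refine SmoothFn.ext fun x => ?_
  have h0 : map (evalAt x).toRingHom P = 0 := by
    refine MvPolynomial.funext fun ξ => ?_
    have := h ξ x
    rw [symbolOp_expWave] at this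
    rw [map_zero]
    exact (mul_eq_zero.1 this).resolve_right (Real.exp_ne_zero _)
  have h1 := congrArg (coeff m) h0
  rw [coeff_map, coeff_zero] at h1
  exact h1

theorem normalOrder_injective {d : ℕ} : Function.Injective (normalOrder (d := d)) := by
  rw [injective_iff_map_eq_zero]
  intro P hP
  refine eq_zero_of_symbolOp_expWave fun ξ x => ?_
  rw [← normalOrder_val, hP]
  rfl

theorem mul_box_cancel {d : ℕ} (hd : 0 < d) {A B : DiffOp d} (h : A * box d = B * box d) :
    A = B := by
  obtain ⟨P, rfl⟩ := normalOrder_surjective A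
  obtain ⟨Q, rfl⟩ := normalOrder_surjective B
  rw [normalOrder_mul_box, normalOrder_mul_box] at h
  rw [pSq_mul_cancel hd (normalOrder_injective h)]

/-! ### Formal adjoints -/

/-- The pairing `∫ f g`. -/
def pairing {d : ℕ} (f g : SmoothFn d) : ℝ := ∫ x, f.1 x * g.1 x

theorem pairing_comm {d : ℕ} (f g : SmoothFn d) : pairing f g = pairing g f := by
  unfold pairing
  congr 1; funext x; ring

theorem pairing_add_right {d : ℕ} {f : SmoothFn d} (hf : HasCompactSupport f.1)
    (g h : SmoothFn d) : pairing f (g + h) = pairing f g + pairing f h := by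
  unfold pairing
  rw [← integral_add (integrable_mul hf) (integrable_mul hf)]
  congr 1; funext x
  exact mul_add _ _ _

theorem pairing_smul_right {d : ℕ} (c : ℝ) (f g : SmoothFn d) :
    pairing f (c • g) = c * pairing f g := by
  unfold pairing
  rw [← integral_const_mul]
  congr 1; funext x
  exact mul_left_comm _ _ _

theorem pairing_sub_right {d : ℕ} {f : SmoothFn d} (hf : HasCompactSupport f.1)
    (g h : SmoothFn d) : pairing f (g - h) = pairing f g - pairing f h := by
  have := pairing_add_right hf (g - h) h
  rw [sub_add_cancel] at this
  linarith

theorem pairing_add_left {d : ℕ} {h : SmoothFn d} (hh : HasCompactSupport h.1)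
    (f g : SmoothFn d) : pairing (f + g) h = pairing f h + pairing g h := by
  rw [pairing_comm, pairing_add_right hh, pairing_comm h, pairing_comm h]

theorem pairing_smul_left {d : ℕ} (c : ℝ) (f g : SmoothFn d) :
    pairing (c • f) g = c * pairing f g := by
  rw [pairing_comm, pairing_smul_right, pairing_comm]

/-- Integration by parts. -/
theorem pairing_partialD {d : ℕ} (i : Fin d) {f g : SmoothFn d} (hf : HasCompactSupport f.1) :
    pairing (partialD i f) g = - pairing f (partialD i g) := by
  have hf' : HasCompactSupport (partialD i f).1 := hf.fderiv_apply (𝕜 := ℝ) _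
  have h := integral_mul_fderiv_eq_neg_fderiv_mul_of_integrable (𝕜 := ℝ) (μ := volume)
    (f := f.1) (g := g.1) (v := Pi.single i 1) (integrable_mul (f := partialD i f) hf')
    (integrable_mul (g := partialD i g) hf) (integrable_mul hf) (fun x _ => f.differentiable x)
    (fun x _ => g.differentiable x)
  change ∫ x, fderiv ℝ f.1 x (Pi.single i 1) * g.1 x
    = - ∫ x, f.1 x * fderiv ℝ g.1 x (Pi.single i 1)
  rw [h, neg_neg]

/-- `A'` is the formal adjoint of `A`. -/
def IsAdjoint {d : ℕ} (A A' : DiffOp d) : Prop :=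
  ∀ f g : SmoothFn d, HasCompactSupport f.1 → HasCompactSupport g.1 →
    pairing (A.1 f) g = pairing f (A'.1 g)

namespace IsAdjoint

variable {d : ℕ} {A A' B B' : DiffOp d}

theorem symm (h : IsAdjoint A A') : IsAdjoint A' A := fun f g hf hg => by
  rw [pairing_comm, ← h g f hg hf, pairing_comm]

theorem mul (hA : IsAdjoint A A') (hB : IsAdjoint B B') : IsAdjoint (A * B) (B' * A') :=
  fun f g hf hg => by
    rw [DiffOp.mul_apply, DiffOp.mul_apply, hA _ _ (hasCompactSupport_diffOp B hf) hg,
      hB _ _ hf (hasCompactSupport_diffOp A' hg)]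

theorem add (hA : IsAdjoint A A') (hB : IsAdjoint B B') : IsAdjoint (A + B) (A' + B') :=
  fun f g hf hg => by
    rw [DiffOp.add_apply, DiffOp.add_apply, pairing_add_left hg, pairing_add_right hf,
      hA _ _ hf hg, hB _ _ hf hg]

theorem smul (c : ℝ) (hA : IsAdjoint A A') : IsAdjoint (c • A) (c • A') := fun f g hf hg => by
  rw [DiffOp.smul_apply, DiffOp.smul_apply, pairing_smul_left, pairing_smul_right, hA _ _ hf hg]

theorem neg (hA : IsAdjoint A A') : IsAdjoint (-A) (-A') := by
  simpa using hA.smul (-1)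

theorem sub (hA : IsAdjoint A A') (hB : IsAdjoint B B') : IsAdjoint (A - B) (A' - B') := by
  simpa [sub_eq_add_neg] using hA.add hB.neg

theorem zero : IsAdjoint (0 : DiffOp d) 0 := by
  intro f g _ _
  have h1 := pairing_smul_left 0 f g
  have h2 := pairing_smul_right 0 f g
  rw [zero_smul, zero_mul] at h1 h2
  exact h1.trans h2.symm

theorem partialOp (i : Fin d) : IsAdjoint (partialOp i) (-partialOp i) := fun f g hf _ => by
  have h : (-MasslessScalar.partialOp i : DiffOp d).1 g = -partialD i g := rfl
  rw [h, ← neg_one_smul ℝ (partialD i g), pairing_smul_right, neg_one_mul]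
  exact pairing_partialD i hf

theorem normalOrder_C (a : SmoothFn d) : IsAdjoint (normalOrder (C a)) (normalOrder (C a)) := by
  intro f g _ _
  rw [normalOrder_val, symbolOp_C]
  change ∫ x, (a.1 x * f.1 x) * g.1 x = ∫ x, f.1 x * (a.1 x * g.1 x)
  congr 1; funext x; ring

theorem box : IsAdjoint (box d) (box d) := by
  unfold MasslessScalar.box
  refine Finset.sum_induction _ (fun A : DiffOp d => IsAdjoint A A) (fun _ _ => add) zero ?_
  intro i _
  simpa using ((partialOp i).mul (partialOp i)).smul (eta i)

end IsAdjoint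

theorem eq_zero_of_pairing_self {d : ℕ} {f : SmoothFn d} (hf : HasCompactSupport f.1)
    (h : pairing f f = 0) : f = 0 := by
  refine SmoothFn.ext fun x => ?_
  have hc : Continuous fun x => f.1 x * f.1 x :=
    f.contDiff.continuous.mul f.contDiff.continuous
  have h0 := (hc.ae_eq_iff_eq volume continuous_const).1
    ((integral_eq_zero_iff_of_nonneg (fun x => mul_self_nonneg (f.1 x)) (integrable_mul hf)).1 h)
  exact mul_self_eq_zero.1 (congrFun h0 x)

/-- Differential operators are local. -/
theorem DiffOp.eventuallyEq {d : ℕ} (A : DiffOp d) {f g : SmoothFn d} {x : Fin d → ℝ}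
    (h : f.1 =ᶠ[nhds x] g.1) : (A.1 f).1 =ᶠ[nhds x] (A.1 g).1 := by
  obtain ⟨A, hA⟩ := A
  change (A f).1 =ᶠ[nhds x] (A g).1
  unfold diffOpSubalgebra at hA
  induction hA using Algebra.adjoin_induction generalizing f g with
  | mem A hA =>
    rcases hA with ⟨a, rfl⟩ | ⟨i, rfl⟩
    · exact (Filter.EventuallyEq.refl _ a.1).mul h
    · filter_upwards [h.fderiv (𝕜 := ℝ)] with y hy
      rw [partialD_apply, partialD_apply, hy]
  | algebraMap r => exact h.const_smul r
  | add A B _ _ hA hB => exact (hA h).add (hB h)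
  | mul A B _ _ hA hB => exact hA (hB h)

theorem exists_bump {d : ℕ} (x : Fin d → ℝ) :
    ∃ χ : SmoothFn d, HasCompactSupport χ.1 ∧ χ.1 =ᶠ[nhds x] 1 := by
  let b : ContDiffBump x := ⟨1, 2, one_pos, one_lt_two⟩
  exact ⟨⟨b, b.contDiff⟩, b.hasCompactSupport, b.eventuallyEq_one⟩

/-- By locality, plane waves may be cut off away from the point where they are tested. -/
theorem eq_zero_of_normalOrder_apply {d : ℕ} {P : Symb d}
    (h : ∀ g : SmoothFn d, HasCompactSupport g.1 → (normalOrder P).1 g = 0) : P = 0 := by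
  refine eq_zero_of_symbolOp_expWave fun ξ x => ?_
  obtain ⟨χ, hχ, h1⟩ := exists_bump x
  set f : SmoothFn d := χ * expWave ξ with hf
  have hfx : ∀ y, f.1 y = χ.1 y * (expWave ξ).1 y := fun _ => rfl
  have hloc : f.1 =ᶠ[nhds x] (expWave ξ).1 := by
    filter_upwards [h1] with y hy
    rw [hfx, hy, Pi.one_apply, one_mul]
  have hc : HasCompactSupport f.1 := by
    rw [show f.1 = χ.1 * (expWave ξ).1 from _root_.funext hfx]
    exact hχ.mul_right
  clear_value f
  have h2 := ((normalOrder P).eventuallyEq hloc).eq_of_nhds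
  rw [h f hc] at h2
  exact h2.symm

/-- A differential operator is determined by its weak action on functions of compact support. -/
theorem DiffOp.eq_of_pairing {d : ℕ} {A B : DiffOp d}
    (h : ∀ f g : SmoothFn d, HasCompactSupport f.1 → HasCompactSupport g.1 →
      pairing f (A.1 g) = pairing f (B.1 g)) : A = B := by
  have h0 : ∀ g : SmoothFn d, HasCompactSupport g.1 → (A - B).1 g = 0 := by
    intro g hg
    have hc := hasCompactSupport_diffOp (A - B) hg
    refine eq_zero_of_pairing_self hc ?_
    have e : (A - B).1 g = A.1 g - B.1 g := rfl
    rw [e] at hc ⊢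
    rw [pairing_sub_right hc, h _ _ hc hg, sub_self]
  obtain ⟨P, hP⟩ := normalOrder_surjective (A - B)
  rw [hP] at h0
  rw [eq_zero_of_normalOrder_apply h0, map_zero] at hP
  exact sub_eq_zero.1 hP

theorem IsAdjoint.unique {d : ℕ} {A B B' : DiffOp d} (h : IsAdjoint A B) (h' : IsAdjoint A B') :
    B = B' :=
  DiffOp.eq_of_pairing fun f g hf hg => by rw [← h f g hf hg, h' f g hf hg]

theorem exists_isAdjoint_monomial {d : ℕ} (k : ℕ) : ∀ (m : Fin d →₀ ℕ) (a : SmoothFn d),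
    m.degree = k → ∃ Q : Symb d, IsAdjoint (normalOrder (monomial m a)) (normalOrder Q) ∧
      Q - (-1 : ℝ) ^ k • monomial m a ∈ symbolsBelow d k := by
  induction k with
  | zero =>
    intro m a hm
    obtain rfl : m = 0 := (Finsupp.degree_eq_zero_iff m).1 hm
    exact ⟨C a, IsAdjoint.normalOrder_C a, by
      rw [pow_zero, one_smul, ← C_apply, sub_self]; exact Submodule.zero_mem _⟩
  | succ k ih =>
    intro m a hm
    obtain ⟨i, hi⟩ : ∃ i, m i ≠ 0 := by
      by_contra h
      push Not at h
      rw [show m = 0 from Finsupp.ext h, map_zero] at hm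
      omega
    have hle : Finsupp.single i 1 ≤ m := by
      simpa [Finsupp.single_le_iff, Nat.one_le_iff_ne_zero] using hi
    obtain ⟨n, rfl⟩ : ∃ n, m = n + Finsupp.single i 1 := ⟨_, (tsub_add_cancel_of_le hle).symm⟩
    rw [map_add, Finsupp.degree_single, add_left_inj] at hm
    obtain ⟨Q, hQ, hQ'⟩ := ih n a hm
    have e : (monomial (n + Finsupp.single i 1) a : Symb d) = monomial n a * X i := by
      rw [X, monomial_mul, mul_one]
    have hmon : (monomial n a : Symb d) ∈ symbolsBelow d (k + 1) :=
      mem_symbolsBelow_of_isHomogeneous (isHomogeneous_monomial a hm) k.lt_succ_self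
    have hQk : Q ∈ symbolsBelow d (k + 1) := by
      have := Submodule.add_mem _ (symbolsBelow_mono k.le_succ hQ')
        (symbolsBelow_real_smul ((-1) ^ k) hmon)
      rwa [sub_add_cancel] at this
    refine ⟨-(X i * Q + coeffD i Q), ?_, ?_⟩
    · rw [e, normalOrder_mul_X, map_neg, ← partialOp_mul_normalOrder, ← neg_mul]
      exact hQ.mul (IsAdjoint.partialOp i)
    · have e2 : -(X i * Q + coeffD i Q) - (-1 : ℝ) ^ (k + 1) • (monomial n a * X i)
          = -(X i * (Q - (-1 : ℝ) ^ k • monomial n a) + coeffD i Q) := by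
        rw [mul_sub, mul_smul_comm, mul_comm (monomial n a), pow_succ, mul_neg_one, neg_smul]
        abel
      rw [e, e2]
      exact Submodule.neg_mem _ (Submodule.add_mem _ (X_mul_mem_symbolsBelow i hQ')
        (coeffD_mem_symbolsBelow i hQk))

/-- Differential operators have formal adjoints, and the symbol of order `k` of the adjoint is
`(-1)^k` times the symbol of order `k`. -/
theorem exists_isAdjoint_normalOrder {d k : ℕ} {P : Symb d} (hP : P ∈ symbolsBelow d (k + 1)) :
    ∃ Q : Symb d, IsAdjoint (normalOrder P) (normalOrder Q) ∧
      Q - (-1 : ℝ) ^ k • P ∈ symbolsBelow d k := by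
  have hmon : ∀ m ∈ P.support, ∃ Q : Symb d,
      IsAdjoint (normalOrder (monomial m (P.coeff m))) (normalOrder Q) ∧
        Q - (-1 : ℝ) ^ k • monomial m (P.coeff m) ∈ symbolsBelow d k := by
    intro m hm
    obtain ⟨Q, hQ, hQ'⟩ := exists_isAdjoint_monomial _ m (P.coeff m) rfl
    refine ⟨Q, hQ, ?_⟩
    have hmk : m.degree ≤ k := by
      by_contra h
      exact mem_support_iff.1 hm (hP m (by omega))
    rcases hmk.eq_or_lt with h | h
    · rwa [h] at hQ'
    · have h1 : monomial m (P.coeff m) ∈ symbolsBelow d k :=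
        mem_symbolsBelow_of_isHomogeneous (isHomogeneous_monomial _ rfl) h
      have h2 := Submodule.add_mem _ (symbolsBelow_mono h.le hQ')
        (symbolsBelow_real_smul ((-1) ^ m.degree) h1)
      rw [sub_add_cancel] at h2
      exact Submodule.sub_mem _ h2 (symbolsBelow_real_smul _ h1)
  choose! Q hQ hQ' using hmon
  refine ⟨∑ m ∈ P.support, Q m, ?_, ?_⟩
  · have hsum : ∀ s : Finset (Fin d →₀ ℕ), s ⊆ P.support →
        IsAdjoint (normalOrder (∑ m ∈ s, monomial m (P.coeff m))) (normalOrder (∑ m ∈ s, Q m)) := by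
      classical
      intro s
      induction s using Finset.induction_on with
      | empty => intro _; simpa using IsAdjoint.zero
      | insert m s hms ih =>
        intro hs
        rw [Finset.sum_insert hms, Finset.sum_insert hms, map_add, map_add]
        exact (hQ m (hs (Finset.mem_insert_self m s))).add
          (ih ((Finset.subset_insert m s).trans hs))
    have h := hsum P.support subset_rfl
    rwa [← P.as_sum] at h
  · have h : ∑ m ∈ P.support, (Q m - (-1 : ℝ) ^ k • monomial m (P.coeff m)) ∈ symbolsBelow d k :=
      Submodule.sum_mem _ hQ'
    rwa [Finset.sum_sub_distrib, ← Finset.smul_sum, ← P.as_sum] at h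

theorem DiffOp.exists_isAdjoint {d : ℕ} (A : DiffOp d) : ∃ A', IsAdjoint A A' := by
  obtain ⟨P, rfl⟩ := normalOrder_surjective A
  obtain ⟨Q, hQ, -⟩ :=
    exists_isAdjoint_normalOrder (mem_symbolsBelow_succ_iff.2 (le_refl P.totalDegree))
  exact ⟨_, hQ⟩

theorem isAntiSelfAdjointOp_iff {d : ℕ} {D : DiffOp d} :
    IsAntiSelfAdjointOp D ↔ IsAdjoint D (-D) := by
  refine forall₄_congr fun f g hf hg => ?_
  have h : (-D).1 g = (-1 : ℝ) • D.1 g := (neg_one_smul ℝ (D.1 g)).symm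
  rw [h, pairing_smul_right, neg_one_mul]
  rfl

/-! ### Matrix form of the BRST complex -/

/-- The operator `A + (B - A) c₀ ∂/∂c₀` of ghost number `0`. -/
def diagOp {d : ℕ} (A B : DiffOp d) : Op d := !![A, 0; 0, B]

/-- The operator `D ∂/∂c₀` of ghost number `-1`. -/
def lowerOp {d : ℕ} (D : DiffOp d) : Op d := !![0, D; 0, 0]

theorem ghostNumber_eq (d : ℕ) : ghostNumber d = !![0, 0; 0, 1] := by
  unfold ghostNumber ghostC ghostD
  ext a b : 2
  fin_cases a <;> fin_cases b <;> simp [Matrix.mul_apply]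

theorem brst_eq (d : ℕ) : brst d = !![0, 0; box d, 0] := by
  unfold brst ghostC
  ext a b : 2
  fin_cases a <;> fin_cases b <;> simp [Matrix.mul_apply]

theorem eq_diagOp {d : ℕ} {K : Op d} (h : HasGhostNumber 0 K) :
    K = diagOp (K 0 0) (K 1 1) := by
  obtain ⟨h1, h2⟩ := entries_of_ghost_zero h
  ext a b : 2
  fin_cases a <;> fin_cases b <;> simp [diagOp, h1, h2]

theorem hasGhostNumber_diagOp {d : ℕ} (A B : DiffOp d) : HasGhostNumber 0 (diagOp A B) := by
  unfold HasGhostNumber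
  rw [ghostNumber_eq, zero_smul, sub_eq_zero]
  ext a b : 2
  fin_cases a <;> fin_cases b <;> simp [diagOp, Matrix.mul_apply]

theorem hasGhostNumber_lowerOp {d : ℕ} (D : DiffOp d) : HasGhostNumber (-1) (lowerOp D) := by
  unfold HasGhostNumber
  rw [ghostNumber_eq]
  ext a b : 2
  fin_cases a <;> fin_cases b <;> simp [lowerOp]

theorem eq_lowerOp {d : ℕ} {T : Op d} (h : HasGhostNumber (-1) T) : T = lowerOp (T 0 1) := by
  unfold HasGhostNumber at h
  rw [ghostNumber_eq, Matrix.eta_fin_two T] at h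
  have h00 := congrFun (congrFun h 0) 0
  have h10 := congrFun (congrFun h 1) 0
  have h11 := congrFun (congrFun h 1) 1
  simp at h00 h10 h11
  have h10' : T 1 0 = 0 := by
    have h2 : (2 : ℝ) • T 1 0 = 0 := by
      rw [two_smul]; nth_rewrite 1 [h10]; exact neg_add_cancel _
    exact (smul_eq_zero.1 h2).resolve_left two_ne_zero
  ext a b : 2
  fin_cases a <;> fin_cases b <;> simp [lowerOp, h00, h11, h10']

theorem brst_commutator_diagOp {d : ℕ} {A B : DiffOp d} :
    brst d * diagOp A B - diagOp A B * brst d = 0 ↔ box d * A = B * box d := by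
  have e : brst d * diagOp A B - diagOp A B * brst d = !![0, 0; box d * A - B * box d, 0] := by
    rw [brst_eq]
    ext a b : 2
    fin_cases a <;> fin_cases b <;> simp [diagOp]
  rw [e, ← sub_eq_zero (a := box d * A)]
  constructor
  · intro h
    exact congrFun (congrFun h 1) 0
  · intro h
    rw [h]
    ext a b : 2
    fin_cases a <;> fin_cases b <;> rfl

theorem brst_anticommutator_lowerOp {d : ℕ} (D : DiffOp d) :
    brst d * lowerOp D + lowerOp D * brst d = diagOp (D * box d) (box d * D) := by
  rw [brst_eq]
  ext a b : 2
  fin_cases a <;> fin_cases b <;> simp [diagOp, lowerOp]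

theorem omega_eq_pairing {d : ℕ} {φ : WaveFn d} (hφ : IsTest φ) (χ : WaveFn d) :
    omega φ χ = pairing (φ 0) (χ 1) - pairing (φ 1) (χ 0) := by
  unfold omega pairing
  rw [← integral_sub (integrable_mul (hφ 0)) (integrable_mul (hφ 1))]

theorem diagOp_act_zero {d : ℕ} (A B : DiffOp d) (φ : WaveFn d) :
    (diagOp A B).act φ 0 = A.1 (φ 0) := by
  have z : ∀ f : SmoothFn d, (0 : DiffOp d).1 f = 0 := fun f => rfl
  simp [Op.act, Fin.sum_univ_two, diagOp, z]

theorem diagOp_act_one {d : ℕ} (A B : DiffOp d) (φ : WaveFn d) :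
    (diagOp A B).act φ 1 = B.1 (φ 1) := by
  have z : ∀ f : SmoothFn d, (0 : DiffOp d).1 f = 0 := fun f => rfl
  simp [Op.act, Fin.sum_univ_two, diagOp, z]

theorem lowerOp_act_zero {d : ℕ} (D : DiffOp d) (φ : WaveFn d) :
    (lowerOp D).act φ 0 = D.1 (φ 1) := by
  have z : ∀ f : SmoothFn d, (0 : DiffOp d).1 f = 0 := fun f => rfl
  simp [Op.act, Fin.sum_univ_two, lowerOp, z]

theorem lowerOp_act_one {d : ℕ} (D : DiffOp d) (φ : WaveFn d) :
    (lowerOp D).act φ 1 = 0 := by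
  have z : ∀ f : SmoothFn d, (0 : DiffOp d).1 f = 0 := fun f => rfl
  simp [Op.act, Fin.sum_univ_two, lowerOp, z]

theorem pairing_zero_right {d : ℕ} (f : SmoothFn d) : pairing f 0 = 0 := by
  simpa using pairing_smul_right 0 f 0

theorem pairing_zero_left {d : ℕ} (f : SmoothFn d) : pairing 0 f = 0 := by
  rw [pairing_comm, pairing_zero_right]

theorem hasCompactSupport_zero {d : ℕ} : HasCompactSupport (0 : SmoothFn d).1 :=
  HasCompactSupport.zero

theorem DiffOp.neg_apply {d : ℕ} (A : DiffOp d) (f : SmoothFn d) :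
    (-A).1 f = (-1 : ℝ) • A.1 f := (neg_one_smul ℝ (A.1 f)).symm

theorem isTest_cons {d : ℕ} {f g : SmoothFn d} (hf : HasCompactSupport f.1)
    (hg : HasCompactSupport g.1) : IsTest (![f, g] : WaveFn d) := by
  intro a
  fin_cases a
  · exact hf
  · exact hg

theorem isSymplectic_diagOp_iff {d : ℕ} {A B : DiffOp d} :
    IsSymplectic 0 (diagOp A B) ↔ IsAdjoint A (-B) := by
  have key : ∀ φ χ : WaveFn d, IsTest φ → IsTest χ →
      omega ((diagOp A B).act φ) χ + omega (paritySign 0 φ) ((diagOp A B).act χ)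
        = (pairing (A.1 (φ 0)) (χ 1) + pairing (φ 0) (B.1 (χ 1)))
          - (pairing (A.1 (χ 0)) (φ 1) + pairing (χ 0) (B.1 (φ 1))) := by
    intro φ χ hφ hχ
    rw [paritySign_zero, omega_eq_pairing (hφ.act _), omega_eq_pairing hφ, diagOp_act_zero,
      diagOp_act_one, diagOp_act_zero, diagOp_act_one, pairing_comm (B.1 (φ 1)),
      pairing_comm (φ 1)]
    ring
  constructor
  · intro h f g hf hg
    have h1 := h ![f, 0] ![0, g] (isTest_cons hf hasCompactSupport_zero)
      (isTest_cons hasCompactSupport_zero hg)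
    rw [key _ _ (isTest_cons hf hasCompactSupport_zero)
      (isTest_cons hasCompactSupport_zero hg)] at h1
    simp only [Matrix.cons_val_zero, Matrix.cons_val_one, pairing_zero_right,
      pairing_zero_left] at h1
    rw [DiffOp.neg_apply, pairing_smul_right]
    linarith
  · intro h φ χ hφ hχ
    have h1 := h _ _ (hφ 0) (hχ 1)
    have h2 := h _ _ (hχ 0) (hφ 1)
    rw [DiffOp.neg_apply, pairing_smul_right] at h1 h2
    rw [key φ χ hφ hχ]
    linarith

theorem isSymplectic_lowerOp_iff {d : ℕ} {D : DiffOp d} :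
    IsSymplectic 1 (lowerOp D) ↔ IsAdjoint D (-D) := by
  have key : ∀ φ χ : WaveFn d, IsTest φ → IsTest χ →
      omega ((lowerOp D).act φ) χ + omega (paritySign 1 φ) ((lowerOp D).act χ)
        = pairing (D.1 (φ 1)) (χ 1) + pairing (φ 1) (D.1 (χ 1)) := by
    intro φ χ hφ hχ
    have hp : paritySign 1 φ 1 = (-1 : ℝ) • φ 1 := by simp [paritySign]
    rw [omega_eq_pairing (hφ.act _), omega_eq_pairing (hφ.paritySign 1), lowerOp_act_zero,
      lowerOp_act_one, lowerOp_act_zero, lowerOp_act_one, hp, pairing_smul_left,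
      pairing_zero_right, pairing_zero_left]
    ring
  constructor
  · intro h f g hf hg
    have h1 := h ![0, f] ![0, g] (isTest_cons hasCompactSupport_zero hf)
      (isTest_cons hasCompactSupport_zero hg)
    rw [key _ _ (isTest_cons hasCompactSupport_zero hf)
      (isTest_cons hasCompactSupport_zero hg)] at h1
    simp only [Matrix.cons_val_one] at h1
    rw [DiffOp.neg_apply, pairing_smul_right]
    simp at h1
    linarith
  · intro h φ χ hφ hχ
    have h1 := h _ _ (hφ 1) (hχ 1)
    rw [DiffOp.neg_apply, pairing_smul_right] at h1
    rw [key φ χ hφ hχ]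
    linarith

/-- Cocycles of ghost number `0` are pairs `(A, B)` with `□ A = B □`. -/
theorem Cocycle.box_mul {d : ℕ} (K : Cocycle d) : box d * K.1 0 0 = K.1 1 1 * box d := by
  have h := K.2.2
  rw [eq_diagOp K.2.1, brst_commutator_diagOp] at h
  exact h

/-- The cocycle with entries `A`, `B` such that `□ A = B □`. -/
def Cocycle.ofPair {d : ℕ} (A B : DiffOp d) (h : box d * A = B * box d) : Cocycle d :=
  ⟨diagOp A B, hasGhostNumber_diagOp A B, brst_commutator_diagOp.2 h⟩

theorem symCocycles_box_mul {d : ℕ} (K : symCocycles d) :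
    box d * K.1 0 0 = K.1 1 1 * box d := by
  have h := K.2.2.2
  rw [eq_diagOp K.2.1, brst_commutator_diagOp] at h
  exact h

theorem symCocycles_isAdjoint {d : ℕ} (K : symCocycles d) :
    IsAdjoint (K.1 0 0) (-(K.1 1 1)) := by
  have h := K.2.2.1
  rwa [eq_diagOp K.2.1, isSymplectic_diagOp_iff] at h

/-- The symplectic cocycle with entries `A`, `B` such that `□ A = B □` and `A† = -B`. -/
def symCocycleOfPair {d : ℕ} (A B : DiffOp d) (h : box d * A = B * box d)
    (h' : IsAdjoint A (-B)) : symCocycles d :=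
  ⟨diagOp A B, hasGhostNumber_diagOp A B, isSymplectic_diagOp_iff.2 h', brst_commutator_diagOp.2 h⟩

theorem symCocycles_ext {d : ℕ} (hd : 0 < d) {K L : symCocycles d} (h : K.1 0 0 = L.1 0 0) :
    K = L := by
  refine Subtype.ext ?_
  rw [eq_diagOp K.2.1, eq_diagOp L.2.1, h]
  congr 1
  refine mul_box_cancel hd ?_
  rw [← symCocycles_box_mul, ← symCocycles_box_mul, h]

theorem Cocycle.mem_coboundaries_iff {d : ℕ} (hd : 0 < d) (K : Cocycle d) :
    K ∈ coboundaries d ↔ ∃ D : DiffOp d, K.1 0 0 = D * box d := by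
  constructor
  · rintro ⟨T, hT, h⟩
    rw [eq_lowerOp hT, brst_anticommutator_lowerOp] at h
    exact ⟨T 0 1, by rw [h]; rfl⟩
  · rintro ⟨D, h⟩
    refine ⟨lowerOp D, hasGhostNumber_lowerOp D, ?_⟩
    rw [brst_anticommutator_lowerOp, eq_diagOp K.2.1, h]
    congr 1
    refine mul_box_cancel hd ?_
    rw [← K.box_mul, h, mul_assoc]

theorem symCocycles_mem_coboundaries_iff {d : ℕ} (hd : 0 < d) (K : symCocycles d) :
    K ∈ symCoboundaries d ↔ ∃ D : DiffOp d, IsAntiSelfAdjointOp D ∧ K.1 0 0 = D * box d := by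
  constructor
  · rintro ⟨T, hT, hs, h⟩
    rw [eq_lowerOp hT, brst_anticommutator_lowerOp] at h
    rw [eq_lowerOp hT, isSymplectic_lowerOp_iff] at hs
    exact ⟨T 0 1, isAntiSelfAdjointOp_iff.2 hs, by rw [h]; rfl⟩
  · rintro ⟨D, hD, h⟩
    rw [isAntiSelfAdjointOp_iff] at hD
    refine ⟨lowerOp D, hasGhostNumber_lowerOp D, isSymplectic_lowerOp_iff.2 hD, ?_⟩
    rw [brst_anticommutator_lowerOp, eq_diagOp K.2.1, h]
    congr 1
    refine mul_box_cancel hd ?_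
    rw [← symCocycles_box_mul, h, mul_assoc]

/-- For a symplectic cocycle triviality does not depend on whether the homotopy is required to be
symplectic: if `A = D □` then `D† □ = -D □`. -/
theorem symCocycles_mem_coboundaries_iff' {d : ℕ} (hd : 0 < d) (K : symCocycles d) :
    K ∈ symCoboundaries d ↔ ∃ D : DiffOp d, K.1 0 0 = D * box d := by
  rw [symCocycles_mem_coboundaries_iff hd]
  refine ⟨fun ⟨D, _, h⟩ => ⟨D, h⟩, fun ⟨D, h⟩ => ⟨D, ?_, h⟩⟩
  have hB : K.1 1 1 = box d * D :=
    mul_box_cancel hd (by rw [← symCocycles_box_mul, h, mul_assoc])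
  obtain ⟨D', hD'⟩ := D.exists_isAdjoint
  have h1 := (symCocycles_isAdjoint K).symm
  have h2 : IsAdjoint (-(K.1 1 1)) (-(D' * box d)) := by
    rw [hB]
    exact (IsAdjoint.box.mul hD').neg
  have h3 : -D = D' := by
    refine mul_box_cancel hd ?_
    rw [neg_mul, ← h, h1.unique h2, neg_neg]
  rw [isAntiSelfAdjointOp_iff, h3]
  exact hD'

/-! ### Variational symmetries -/

theorem action_eq {d : ℕ} (φ : SmoothFn d) :
    action φ = 1 / 2 * pairing φ ((box d).1 φ) := rfl

theorem isVariationalSymmetry_iff {d : ℕ} {A : DiffOp d} :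
    IsVariationalSymmetry A ↔
      ∀ φ : SmoothFn d, HasCompactSupport φ.1 → pairing φ ((box d * A).1 φ) = 0 := by
  refine forall₂_congr fun φ hφ => ?_
  set ψ := A.1 φ with hψ
  have hψc : HasCompactSupport ψ.1 := hasCompactSupport_diffOp A hφ
  have hbox : pairing ψ ((box d).1 φ) = pairing φ ((box d).1 ψ) := by
    rw [pairing_comm, IsAdjoint.box φ ψ hφ hψc]
  have e : ∀ ε : ℝ, action (φ + ε • ψ) = action φ + ε * pairing φ ((box d).1 ψ)
      + ε ^ 2 * action ψ := by
    intro ε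
    have hs : HasCompactSupport (ε • ψ).1 := HasCompactSupport.mul_left (f := fun _ => ε) hψc
    rw [action_eq, action_eq, action_eq, map_add, map_smul,
      pairing_add_right (hasCompactSupport_add hφ hs), pairing_smul_right, pairing_comm (φ + _),
      pairing_add_right (hasCompactSupport_diffOp _ hφ), pairing_smul_right,
      pairing_comm (φ + _), pairing_add_right (hasCompactSupport_diffOp _ hψc), pairing_smul_right,
      pairing_comm _ φ, pairing_comm _ ψ, pairing_comm _ φ, pairing_comm _ ψ, hbox]
    ring
  have hder : HasDerivAt (fun ε : ℝ => action (φ + ε • ψ)) (pairing φ ((box d).1 ψ)) 0 := by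
    simp_rw [e]
    have h1 : HasDerivAt (fun ε : ℝ => action φ + ε * pairing φ ((box d).1 ψ) + ε ^ 2 * action ψ)
        (1 * pairing φ ((box d).1 ψ) + (2 * (0 : ℝ) ^ (2 - 1) * 1) * action ψ) 0 :=
      (((hasDerivAt_id (0 : ℝ)).mul_const _).const_add _).add
        (((hasDerivAt_id (0 : ℝ)).pow 2).mul_const _)
    simpa using h1
  exact ⟨fun h => hder.unique h, fun h => h ▸ hder⟩

/-- Polarisation. -/
theorem isAdjoint_neg_self_of_pairing_eq_zero {d : ℕ} {C : DiffOp d}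
    (h : ∀ φ : SmoothFn d, HasCompactSupport φ.1 → pairing φ (C.1 φ) = 0) : IsAdjoint C (-C) := by
  intro f g hf hg
  have h1 := h (f + g) (hasCompactSupport_add hf hg)
  rw [map_add, pairing_add_right (hasCompactSupport_add hf hg),
    pairing_add_left (hasCompactSupport_diffOp C hf),
    pairing_add_left (hasCompactSupport_diffOp C hg), h f hf, h g hg] at h1
  rw [DiffOp.neg_apply, pairing_smul_right, pairing_comm]
  linarith

theorem isVariationalSymmetry_iff_existsUnique {d : ℕ} (hd : 0 < d) (A : DiffOp d) :
    IsVariationalSymmetry A ↔ ∃! K : symCocycles d, K.1 0 0 = A := by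
  rw [isVariationalSymmetry_iff]
  constructor
  · intro h
    have hC := isAdjoint_neg_self_of_pairing_eq_zero h
    obtain ⟨A', hA'⟩ := A.exists_isAdjoint
    have h1 : box d * A = -A' * box d := by
      rw [neg_mul, (IsAdjoint.box.mul hA').unique hC, neg_neg]
    exact ⟨symCocycleOfPair A (-A') h1 (by rwa [neg_neg]), rfl,
      fun K hK => symCocycles_ext hd hK⟩
  · rintro ⟨K, rfl, -⟩ φ hφ
    have h1 := symCocycles_isAdjoint K φ ((box d).1 φ) hφ (hasCompactSupport_diffOp _ hφ)
    rw [DiffOp.neg_apply, pairing_smul_right, ← DiffOp.mul_apply, ← symCocycles_box_mul] at h1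
    have h2 := IsAdjoint.box φ ((K.1 0 0).1 φ) hφ (hasCompactSupport_diffOp _ hφ)
    rw [← DiffOp.mul_apply, pairing_comm] at h2
    linarith

/-! ### Eastwood's algebra and its anti-self-adjoint part -/

theorem Cocycle.ext {d : ℕ} (hd : 0 < d) {K L : Cocycle d} (h : K.1 0 0 = L.1 0 0) : K = L := by
  refine Subtype.ext ?_
  rw [eq_diagOp K.2.1, eq_diagOp L.2.1, h]
  congr 1
  exact mul_box_cancel hd (by rw [← K.box_mul, ← L.box_mul, h])

/-- The map `K ↦ A` from cocycles to symmetries of the wave equation. -/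
def cocycleToEom (d : ℕ) : Cocycle d →ₐ[ℝ] EomSymmetry d where
  toFun K := ⟨K.1 0 0, K.1 1 1, K.box_mul⟩
  map_one' := rfl
  map_zero' := rfl
  map_add' _ _ := rfl
  map_mul' K L := by
    refine Subtype.ext ?_
    change (K.1 * L.1) 0 0 = K.1 0 0 * L.1 0 0
    rw [Matrix.mul_apply, Fin.sum_univ_two, (entries_of_ghost_zero K.2.1).1, zero_mul, add_zero]
  commutes' _ := rfl

theorem cocycleToEom_bijective {d : ℕ} (hd : 0 < d) : Function.Bijective (cocycleToEom d) :=
  ⟨fun _ _ h => Cocycle.ext hd (congrArg Subtype.val h),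
    fun A => ⟨Cocycle.ofPair A.1 A.2.choose A.2.choose_spec, rfl⟩⟩

/-- The operator `B` is determined by `A`, so cocycles are the symmetries of the wave equation. -/
def cocycleEquivEom {d : ℕ} (hd : 0 < d) : Cocycle d ≃ₐ[ℝ] EomSymmetry d :=
  AlgEquiv.ofBijective (cocycleToEom d) (cocycleToEom_bijective hd)

theorem map_coboundaries {d : ℕ} (hd : 0 < d) :
    eomTrivial d = (coboundaries d).map (cocycleEquivEom hd : Cocycle d →+* EomSymmetry d) := by
  ext A
  rw [Ideal.mem_map_iff_of_surjective (cocycleEquivEom hd : Cocycle d →+* EomSymmetry d)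
    (cocycleEquivEom hd).surjective]
  constructor
  · rintro ⟨D, h⟩
    obtain ⟨K, rfl⟩ := (cocycleEquivEom hd).surjective A
    exact ⟨K, (K.mem_coboundaries_iff hd).2 ⟨D, h⟩, rfl⟩
  · rintro ⟨K, hK, rfl⟩
    exact (K.mem_coboundaries_iff hd).1 hK

/-- `[K] ↦ [A]`. -/
def cohomologyEquivEastwood {d : ℕ} (hd : 0 < d) : Cohomology d ≃ₐ[ℝ] EastwoodAlgebra d :=
  Ideal.quotientEquivAlg (coboundaries d) (eomTrivial d) (cocycleEquivEom hd) (map_coboundaries hd)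

theorem cohomologyEquivEastwood_mk {d : ℕ} (hd : 0 < d) {K : Cocycle d} {A : EomSymmetry d}
    (h : A.1 = K.1 0 0) : cohomologyEquivEastwood hd (Ideal.Quotient.mk (coboundaries d) K)
      = Ideal.Quotient.mk (eomTrivial d) A :=
  congrArg (Ideal.Quotient.mk (eomTrivial d)) (show cocycleEquivEom hd K = A from Subtype.ext h.symm)

/-- Forgetting that a cocycle is symplectic. -/
def symCocycleToCocycle (d : ℕ) : symCocycles d →ₗ⁅ℝ⁆ Cocycle d where
  toFun K := ⟨K.1, K.2.1, K.2.2.2⟩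
  map_add' _ _ := rfl
  map_smul' _ _ := rfl
  map_lie' := rfl

/-- The class in `H⁰` of a symplectic cocycle. -/
def symCocycleToCohomology (d : ℕ) : symCocycles d →ₗ⁅ℝ⁆ Cohomology d :=
  (Ideal.Quotient.mkₐ ℝ (coboundaries d)).toLieHom.comp (symCocycleToCocycle d)

theorem symCocycleToCohomology_eq_zero_iff {d : ℕ} (hd : 0 < d) (K : symCocycles d) :
    symCocycleToCohomology d K = 0 ↔ K ∈ symCoboundaries d := by
  rw [symCocycles_mem_coboundaries_iff' hd]
  exact Ideal.Quotient.eq_zero_iff_mem.trans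
    (Cocycle.mem_coboundaries_iff hd (symCocycleToCocycle d K))

/-- The natural map `H⁰_sym → H⁰`. -/
def symCohomologyToCohomology {d : ℕ} (hd : 0 < d) : SymCohomology d →ₗ⁅ℝ⁆ Cohomology d where
  toLinearMap := Submodule.liftQ (symCoboundaries d).toSubmodule
    (symCocycleToCohomology d).toLinearMap
    fun K hK => (symCocycleToCohomology_eq_zero_iff hd K).2 hK
  map_lie' := by
    intro a b
    obtain ⟨K, rfl⟩ := LieSubmodule.Quotient.surjective_mk' (symCoboundaries d) a
    obtain ⟨L, rfl⟩ := LieSubmodule.Quotient.surjective_mk' (symCoboundaries d) b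
    exact (symCocycleToCohomology d).map_lie K L

theorem symCohomologyToCohomology_mk {d : ℕ} (hd : 0 < d) (K : symCocycles d) :
    symCohomologyToCohomology hd (SymCohomology.mk K) = symCocycleToCohomology d K := rfl

theorem SymCohomology.mk_surjective {d : ℕ} (a : SymCohomology d) : ∃ K, SymCohomology.mk K = a :=
  LieSubmodule.Quotient.surjective_mk' (symCoboundaries d) a

theorem symCohomologyToCohomology_injective {d : ℕ} (hd : 0 < d) :
    Function.Injective (symCohomologyToCohomology hd) := by
  rw [injective_iff_map_eq_zero]
  intro a ha
  obtain ⟨K, rfl⟩ := SymCohomology.mk_surjective a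
  exact LieSubmodule.Quotient.mk_eq_zero'.2 ((symCocycleToCohomology_eq_zero_iff hd K).1 ha)

/-- If `L` is the adjoint of `K`, then the anti-self-adjoint part of `K` is symplectic. -/
theorem isSymplectic_half_sub {d : ℕ} {K L : Op d}
    (h : ∀ φ χ : WaveFn d, IsTest φ → IsTest χ → omega (K.act φ) χ = omega φ (L.act χ)) :
    IsSymplectic 0 ((2⁻¹ : ℝ) • (K - L)) := by
  refine IsSymplectic.smul _ fun φ χ hφ hχ => ?_
  rw [paritySign_zero, act_sub, act_sub, omega_sub_left _ (hφ.act K) (hφ.act L),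
    omega_sub_right _ (hχ.act K) (hχ.act L), h φ χ hφ hχ, omega_swap (L.act φ), ← h χ φ hχ hφ,
    omega_swap (K.act χ)]
  ring

theorem range_symCohomologyToCohomology {d : ℕ} (hd : 0 < d) :
    Set.range (symCohomologyToCohomology hd) = {a | IsAntiSelfAdjointClass a} := by
  ext a
  constructor
  · rintro ⟨b, rfl⟩
    obtain ⟨K, rfl⟩ := SymCohomology.mk_surjective b
    refine ⟨symCocycleToCocycle d K, -symCocycleToCocycle d K, rfl, map_neg _ _, ?_⟩
    intro φ χ hφ hχ
    have h := K.2.2.1 φ χ hφ hχ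
    rw [paritySign_zero] at h
    have e : Op.act (-symCocycleToCocycle d K).1 χ = (-1 : ℝ) • Op.act K.1 χ := by
      rw [← act_smul, neg_one_smul]; rfl
    rw [e, omega_smul_right]
    change omega (Op.act K.1 φ) χ = _
    linarith
  · rintro ⟨K, L, rfl, hL, h⟩
    have hs : IsSymplectic 0 ((2⁻¹ : ℝ) • (K - L)).1 := isSymplectic_half_sub h
    set M : Cocycle d := (2⁻¹ : ℝ) • (K - L) with hM
    refine ⟨SymCohomology.mk ⟨M.1, M.2.1, hs, M.2.2⟩, ?_⟩
    change Ideal.Quotient.mkₐ ℝ (coboundaries d) M = _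
    rw [hM, map_smul, map_sub]
    change (2⁻¹ : ℝ) • (Ideal.Quotient.mk (coboundaries d) K - Ideal.Quotient.mk (coboundaries d) L)
      = _
    rw [hL, sub_neg_eq_add, ← two_smul ℝ, smul_smul]
    norm_num

/-! ### Principal symbols of variational symmetries -/

theorem coeffD_pSq_mul {d : ℕ} (i : Fin d) (V : Symb d) :
    coeffD i (pSq d * V) = pSq d * coeffD i V := by
  unfold pSq
  rw [Finset.sum_mul, Finset.sum_mul, coeffD_sum]
  exact Finset.sum_congr rfl fun j _ => by
    rw [smul_mul_assoc, smul_mul_assoc, mul_assoc, mul_assoc, coeffD_smul, coeffD_X_mul,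
      coeffD_X_mul]

theorem pGrad_pSq_mul {d : ℕ} (V : Symb d) : pGrad (pSq d * V) = pSq d * pGrad V := by
  unfold pGrad
  rw [Finset.mul_sum]
  exact Finset.sum_congr rfl fun i _ => by
    rw [coeffD_pSq_mul, mul_smul_comm, mul_left_comm]

/-- Every conformal Killing tensor of odd rank is the principal symbol of a symplectic cocycle. If
`□ A = δ □` has symbol `V`, then so has the anti-self-adjoint part `(A - δ†) / 2`. -/
theorem exists_symCocycle_of_conformalKilling {d k : ℕ} (hd : 3 ≤ d) (hk : Odd k)
    (V : conformalKilling d k) : ∃ K : symCocycles d, ∃ P ∈ symbolsBelow d k,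
      K.1 0 0 = normalOrder (V.1 + P) := by
  obtain ⟨hV, ht, hG⟩ := V.2
  obtain ⟨n, rfl⟩ := Nat.exists_eq_succ_of_ne_zero hk.pos.ne'
  obtain ⟨A, W, hA, e⟩ := exists_symbol_of_conformalKilling hd hV ht hG
  have hAk : A ∈ symbolsBelow d (n + 2) := by
    have h1 := Submodule.add_mem _ (symbolsBelow_mono (n + 1).le_succ hA)
      (mem_symbolsBelow_of_isHomogeneous hV (n + 1).lt_succ_self)
    rwa [sub_add_cancel] at h1
  have hW : W ∈ symbolsBelow d (n + 1) := by
    refine mem_symbolsBelow_of_pSq_mul (by omega) ?_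
    rw [← e]
    exact Submodule.add_mem _ (symbolsBelow_real_smul _ (pGrad_mem_symbolsBelow hAk))
      (symbolsBelow_mono (n + 2).le_succ (coeffBox_mem_symbolsBelow hAk))
  obtain ⟨Q, hQ, hQ'⟩ := exists_isAdjoint_normalOrder
    (Submodule.add_mem _ hAk (symbolsBelow_mono (n + 1).le_succ hW))
  obtain ⟨A', hA'⟩ := (normalOrder A).exists_isAdjoint
  have h1 : box d * normalOrder A = normalOrder (A + W) * box d := by
    rw [box_mul_normalOrder, normalOrder_mul_box, e, mul_add]
  have h2 : box d * normalOrder Q = A' * box d := by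
    have h3 := hQ.mul IsAdjoint.box
    rw [← h1] at h3
    exact h3.unique (IsAdjoint.box.mul hA')
  refine ⟨symCocycleOfPair ((2⁻¹ : ℝ) • (normalOrder A - normalOrder Q))
    ((2⁻¹ : ℝ) • (normalOrder (A + W) - A')) ?_ ?_, (2⁻¹ : ℝ) • (A - Q) - V.1, ?_, ?_⟩
  · rw [mul_smul_comm, smul_mul_assoc, mul_sub, sub_mul, h1, h2]
  · rw [← smul_neg, neg_sub]
    exact (hA'.sub hQ.symm).smul _
  · rw [Odd.neg_one_pow hk, neg_one_smul, sub_neg_eq_add] at hQ'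
    have h3 : (2⁻¹ : ℝ) • (A - Q) - V.1
        = (A - V.1) + (2⁻¹ : ℝ) • W - (2⁻¹ : ℝ) • (Q + (A + W)) := by module
    rw [h3]
    exact Submodule.sub_mem _ (Submodule.add_mem _ hA (symbolsBelow_real_smul _ hW))
      (symbolsBelow_real_smul _ hQ')
  · change (2⁻¹ : ℝ) • (normalOrder A - normalOrder Q) = _
    rw [add_sub_cancel, map_smul, map_sub]

/-- The lift of conformal Killing tensors to symplectic cocycles can be chosen linear. -/
theorem exists_linear_lift {d k : ℕ} (hd : 3 ≤ d) (hk : Odd k) :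
    ∃ s : conformalKilling d k →ₗ[ℝ] symCocycles d, ∀ V : conformalKilling d k,
      ∃ P ∈ symbolsBelow d k, (s V).1 0 0 = normalOrder (V.1 + P) := by
  -- Over a field, the projection from the pairs `(K, V)` such that `V` is the symbol of `K` to the
  -- second component has a linear section.
  let S : Submodule ℝ (symCocycles d × conformalKilling d k) :=
    { carrier := {x | ∃ P ∈ symbolsBelow d k, x.1.1 0 0 = normalOrder (x.2.1 + P)}
      add_mem' := by
        rintro x y ⟨P, hP, h⟩ ⟨Q, hQ, h'⟩
        refine ⟨P + Q, Submodule.add_mem _ hP hQ, ?_⟩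
        change x.1.1 0 0 + y.1.1 0 0 = normalOrder (x.2.1 + y.2.1 + (P + Q))
        rw [h, h', ← map_add, add_add_add_comm]
      zero_mem' := ⟨0, Submodule.zero_mem _, by
        change (0 : DiffOp d) = normalOrder (0 + 0)
        rw [add_zero, map_zero]⟩
      smul_mem' := by
        rintro c x ⟨P, hP, h⟩
        refine ⟨c • P, symbolsBelow_real_smul c hP, ?_⟩
        change c • x.1.1 0 0 = normalOrder (c • x.2.1 + c • P)
        rw [h, ← smul_add, map_smul] }
  have hsurj : Function.Surjective ((LinearMap.snd ℝ _ _).comp S.subtype) := fun V => by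
    obtain ⟨K, P, hP, h⟩ := exists_symCocycle_of_conformalKilling hd hk V
    exact ⟨⟨(K, V), P, hP, h⟩, rfl⟩
  obtain ⟨g, hg⟩ := LinearMap.exists_rightInverse_of_surjective _ (LinearMap.range_eq_top.2 hsurj)
  refine ⟨(LinearMap.fst ℝ _ _).comp (S.subtype.comp g), fun V => ?_⟩
  obtain ⟨P, hP, h⟩ := (g V).2
  have hV : (g V).1.2 = V := LinearMap.congr_fun hg V
  rw [hV] at h
  exact ⟨P, hP, h⟩

/-- A linear lift of conformal Killing tensors of odd rank to symplectic cocycles. -/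
def conformalLift {d : ℕ} (hd : 3 ≤ d) (k : {k : ℕ // Odd k}) :
    conformalKilling d k →ₗ[ℝ] symCocycles d := (exists_linear_lift hd k.2).choose

theorem conformalLift_spec {d : ℕ} (hd : 3 ≤ d) (k : {k : ℕ // Odd k})
    (V : conformalKilling d k) : ∃ P ∈ symbolsBelow d k,
      (conformalLift hd k V).1 0 0 = normalOrder (V.1 + P) :=
  (exists_linear_lift hd k.2).choose_spec V

/-- The sum of the lifts of the components. -/
def conformalLiftSum {d : ℕ} (hd : 3 ≤ d) : OddConformalKilling d →ₗ[ℝ] symCocycles d :=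
  DirectSum.toModule ℝ _ _ (conformalLift hd)

theorem conformalLiftSum_of {d : ℕ} (hd : 3 ≤ d) (k : {k : ℕ // Odd k}) (V : conformalKilling d k) :
    conformalLiftSum hd (DirectSum.of (fun j : {j : ℕ // Odd j} => conformalKilling d j) k V)
      = conformalLift hd k V := by
  unfold conformalLiftSum
  rw [← DirectSum.lof_eq_of ℝ, DirectSum.toModule_lof]

/-- The symplectic cocycles `K` for which `A` has order less than `n`. -/
def symCocyclesBelow (d n : ℕ) : Submodule ℝ (symCocycles d) where
  carrier := {K | ∃ P ∈ symbolsBelow d n, K.1 0 0 = normalOrder P}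
  add_mem' := by
    rintro K L ⟨P, hP, h⟩ ⟨Q, hQ, h'⟩
    refine ⟨P + Q, Submodule.add_mem _ hP hQ, ?_⟩
    change K.1 0 0 + L.1 0 0 = _
    rw [h, h', map_add]
  zero_mem' := ⟨0, Submodule.zero_mem _, (map_zero normalOrder).symm⟩
  smul_mem' := by
    rintro c K ⟨P, hP, h⟩
    refine ⟨c • P, symbolsBelow_real_smul c hP, ?_⟩
    change c • K.1 0 0 = _
    rw [h, map_smul]

theorem conformalLiftSum_mem {d n : ℕ} (hd : 3 ≤ d) (v : OddConformalKilling d)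
    (hv : ∀ j : {j : ℕ // Odd j}, n ≤ j → v j = 0) :
    conformalLiftSum hd v ∈ symCocyclesBelow d n := by
  classical
  rw [← DirectSum.sum_support_of v, map_sum]
  refine Submodule.sum_mem _ fun j hj => ?_
  have hjn : j.1 < n := by
    by_contra h
    exact DFinsupp.mem_support_iff.1 hj (hv j (not_lt.1 h))
  rw [conformalLiftSum_of]
  obtain ⟨P, hP, h⟩ := conformalLift_spec hd j (v j)
  exact ⟨_, Submodule.add_mem _ (mem_symbolsBelow_of_isHomogeneous (v j).2.1 hjn)
    (symbolsBelow_mono hjn.le hP), h⟩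

/-- The principal symbol of the lift of `v` is the top component of `v`. -/
theorem conformalLiftSum_symbol {d : ℕ} (hd : 3 ≤ d) (v : OddConformalKilling d)
    (k : {k : ℕ // Odd k}) (hv : ∀ j : {j : ℕ // Odd j}, k.1 < j → v j = 0) :
    ∃ P ∈ symbolsBelow d k, (conformalLiftSum hd v).1 0 0 = normalOrder ((v k).1 + P) := by
  set w := v - DirectSum.of (fun j : {j : ℕ // Odd j} => conformalKilling d j) k (v k) with hw
  have hw0 : ∀ j : {j : ℕ // Odd j}, k.1 ≤ j → w j = 0 := by
    intro j hj
    rw [hw, DirectSum.sub_apply]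
    rcases eq_or_ne k j with rfl | hne
    · rw [DirectSum.of_eq_same, sub_self]
    · rw [DirectSum.of_eq_of_ne _ _ _ hne.symm, sub_zero]
      exact hv j (lt_of_le_of_ne hj fun h => hne (Subtype.ext h))
  obtain ⟨P, hP, h⟩ := conformalLiftSum_mem hd w hw0
  obtain ⟨Q, hQ, h'⟩ := conformalLift_spec hd k (v k)
  refine ⟨Q + P, Submodule.add_mem _ hQ hP, ?_⟩
  rw [← conformalLiftSum_of] at h'
  rw [← add_assoc, map_add, ← h, ← h', hw, map_sub]
  exact (add_sub_cancel _ _).symm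

/-- The map from conformal Killing tensors to classes of variational symmetries. -/
def conformalClass {d : ℕ} (hd : 3 ≤ d) : OddConformalKilling d →ₗ[ℝ] SymCohomology d :=
  (symCoboundaries d).toSubmodule.mkQ.comp (conformalLiftSum hd)

theorem conformalClass_apply {d : ℕ} (hd : 3 ≤ d) (v : OddConformalKilling d) :
    conformalClass hd v = SymCohomology.mk (conformalLiftSum hd v) := rfl

theorem SymCohomology.mk_eq_zero_iff {d : ℕ} (K : symCocycles d) :
    SymCohomology.mk K = 0 ↔ K ∈ symCoboundaries d := LieSubmodule.Quotient.mk_eq_zero'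

theorem SymCohomology.mk_sub {d : ℕ} (K L : symCocycles d) :
    SymCohomology.mk (K - L) = SymCohomology.mk K - SymCohomology.mk L := rfl

/-- The symbol of a trivial symmetry is a multiple of `p²`, and a trace-free multiple of `p²`
vanishes. -/
theorem conformalClass_injective {d : ℕ} (hd : 3 ≤ d) :
    Function.Injective (conformalClass hd) := by
  classical
  have hd0 : 0 < d := by omega
  rw [injective_iff_map_eq_zero]
  have key : ∀ (n : ℕ) (v : OddConformalKilling d), conformalClass hd v = 0 →
      (∀ j : {j : ℕ // Odd j}, n ≤ j → v j = 0) → v = 0 := by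
    intro n
    induction n with
    | zero => exact fun v _ hv => DFinsupp.ext fun j => hv j (Nat.zero_le _)
    | succ n ih =>
      intro v hv hn
      refine ih v hv fun j hj => ?_
      rcases hj.lt_or_eq with hlt | rfl
      · exact hn j hlt
      obtain ⟨P, hP, h⟩ := conformalLiftSum_symbol hd v j hn
      rw [conformalClass_apply, SymCohomology.mk_eq_zero_iff,
        symCocycles_mem_coboundaries_iff' hd0] at hv
      obtain ⟨D, hD⟩ := hv
      obtain ⟨R, rfl⟩ := normalOrder_surjective D
      rw [h, normalOrder_mul_box] at hD
      have h1 : (v j).1 - pSq d * R ∈ symbolsBelow d j := by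
        rw [← normalOrder_injective hD, sub_add_cancel_left]
        exact Submodule.neg_mem _ hP
      obtain ⟨Q, hQ, h2⟩ := exists_eq_pSq_mul (v j).2.1 h1
      exact Subtype.ext (eq_zero_of_trace_eq_zero_of_eq_pSq_mul hd0 hQ (v j).2.2.1 h2)
  intro v hv
  refine key (v.support.sup Subtype.val + 1) v hv fun j hj => ?_
  by_contra h
  have := Finset.le_sup (f := Subtype.val) (DFinsupp.mem_support_iff.2 h)
  omega

/-- For odd `k` a multiple of `p²` of order `k` is the principal symbol of a trivial variational
symmetry. -/
theorem exists_trivial_symbol {d k : ℕ} (hk : Odd k) {Q : Symb d}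
    (hQ : Q ∈ symbolsBelow d (k - 1)) :
    ∃ L ∈ symCoboundaries d, ∃ E ∈ symbolsBelow d k, L.1 0 0 = normalOrder (pSq d * Q + E) := by
  rcases lt_or_ge k 2 with h | h
  -- For `k = 1` the hypothesis means `Q = 0`.
  · rw [show k - 1 = 0 by omega] at hQ
    refine ⟨0, LieSubmodule.zero_mem _, 0, Submodule.zero_mem _, ?_⟩
    rw [eq_zero_of_mem_symbolsBelow_zero hQ, mul_zero, add_zero, map_zero]
    rfl
  obtain ⟨m, rfl⟩ := Nat.exists_eq_add_of_le' h
  have hm : Odd m := by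
    rcases Nat.even_or_odd m with h | h
    · exact absurd hk (Nat.not_odd_iff_even.2 (h.add even_two))
    · exact h
  obtain ⟨Q', hQ', h'⟩ := exists_isAdjoint_normalOrder (k := m) hQ
  rw [hm.neg_one_pow, neg_one_smul, sub_neg_eq_add] at h'
  set D : DiffOp d := (2⁻¹ : ℝ) • (normalOrder Q - normalOrder Q') with hDdef
  have hD : IsAdjoint D (-D) := by
    have h1 := (hQ'.sub hQ'.symm).smul (2⁻¹ : ℝ)
    rwa [← neg_sub (normalOrder Q), smul_neg] at h1
  have hadj : IsAdjoint (D * box d) (-(box d * D)) := by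
    rw [← mul_neg]
    exact hD.mul IsAdjoint.box
  refine ⟨symCocycleOfPair (D * box d) (box d * D) (mul_assoc _ _ _).symm hadj,
    ⟨lowerOp D, hasGhostNumber_lowerOp D, isSymplectic_lowerOp_iff.2 hD,
      (brst_anticommutator_lowerOp D).symm⟩,
    pSq d * (-((2⁻¹ : ℝ) • (Q' + Q))), pSq_mul_mem_symbolsBelow
      (Submodule.neg_mem _ (symbolsBelow_real_smul _ h')), ?_⟩
  change D * box d = _
  rw [hDdef, ← map_sub, ← map_smul, normalOrder_mul_box, ← mul_add]
  congr 2
  module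

/-- For a symplectic cocycle with `A` of order at most `k`, the equation `□ A = B □` says that
`2 p·∂_x P + □_x P` is a multiple of `p²`. For even `k` the symbol of order `k` vanishes, because
`A† = -B` while `A` and `B` have the same symbol of order `k`. -/
theorem symCocycles_symbol {d k : ℕ} (hd : 0 < d) {K : symCocycles d} {P : Symb d}
    (hP : P ∈ symbolsBelow d (k + 1)) (h : K.1 0 0 = normalOrder P) :
    (Even k → P ∈ symbolsBelow d k) ∧
      ∃ W : Symb d, (2 : ℝ) • pGrad P + coeffBox P = pSq d * W := by
  obtain ⟨R, hR⟩ := normalOrder_surjective (K.1 1 1)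
  have h1 := symCocycles_box_mul K
  rw [h, hR, box_mul_normalOrder, normalOrder_mul_box] at h1
  have h2 : (2 : ℝ) • pGrad P + coeffBox P = pSq d * (R - P) := by
    rw [mul_sub, ← normalOrder_injective h1, add_sub_cancel_left]
  refine ⟨fun hk => ?_, R - P, h2⟩
  have h3 : R - P ∈ symbolsBelow d k := by
    refine mem_symbolsBelow_of_pSq_mul hd ?_
    rw [← h2]
    exact Submodule.add_mem _ (symbolsBelow_real_smul _ (pGrad_mem_symbolsBelow hP))
      (symbolsBelow_mono (k + 1).le_succ (coeffBox_mem_symbolsBelow hP))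
  obtain ⟨Q, hQ, hQ'⟩ := exists_isAdjoint_normalOrder hP
  have h4 := symCocycles_isAdjoint K
  rw [h, hR, ← map_neg] at h4
  rw [← normalOrder_injective (h4.unique hQ), hk.neg_one_pow, one_smul] at hQ'
  have h5 : P = (-2⁻¹ : ℝ) • ((R - P) + (-R - P)) := by module
  rw [h5]
  exact symbolsBelow_real_smul _ (Submodule.add_mem _ h3 hQ')

/-- The trace-free part of the principal symbol of a symmetry is a conformal Killing tensor. -/
theorem trace_free_part_mem_conformalKilling {d k : ℕ} {P V Q W : Symb d}
    (hP : P ∈ symbolsBelow d (k + 1)) (hW : (2 : ℝ) • pGrad P + coeffBox P = pSq d * W)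
    (hV : V.IsHomogeneous k) (ht : trace V = 0) (h : homogeneousComponent k P = V + pSq d * Q) :
    V ∈ conformalKilling d k := by
  have hlow := sub_homogeneousComponent_mem_symbolsBelow hP
  rw [h] at hlow
  have h1 : pGrad V - pSq d * ((2⁻¹ : ℝ) • W - pGrad Q) ∈ symbolsBelow d (k + 1) := by
    have e : pGrad V - pSq d * ((2⁻¹ : ℝ) • W - pGrad Q)
        = -(pGrad (P - (V + pSq d * Q)) + (2⁻¹ : ℝ) • coeffBox P) := by
      rw [mul_sub, mul_smul_comm, ← hW, pGrad_sub, pGrad_add, pGrad_pSq_mul]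
      module
    rw [e]
    exact Submodule.neg_mem _ (Submodule.add_mem _ (pGrad_mem_symbolsBelow hlow)
      (symbolsBelow_real_smul _ (coeffBox_mem_symbolsBelow hP)))
  obtain ⟨W', -, hW'⟩ := exists_eq_pSq_mul (isHomogeneous_pGrad hV) h1
  exact ⟨hV, ht, W', hW'⟩

/-- Every class of variational symmetries comes from conformal Killing tensors, by descent on the
order: subtracting the lift of the trace-free part of the principal symbol and a trivial symmetry
lowers the order. -/
theorem exists_conformalClass_eq {d : ℕ} (hd : 3 ≤ d) (n : ℕ) : ∀ (K : symCocycles d) (P : Symb d),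
    P ∈ symbolsBelow d n → K.1 0 0 = normalOrder P →
    ∃ v : OddConformalKilling d, conformalClass hd v = SymCohomology.mk K ∧
      (∀ j : {j : ℕ // Odd j}, n ≤ j → v j = 0) ∧
      ∀ j : {j : ℕ // Odd j}, n = j + 1 → ∃ Q : Symb d,
        homogeneousComponent j.1 P = (v j).1 + pSq d * Q := by
  have hd0 : 0 < d := by omega
  induction n with
  | zero =>
    intro K P hP h
    refine ⟨0, ?_, fun _ _ => rfl, fun j hj => by omega⟩
    rw [map_zero]
    symm
    rw [SymCohomology.mk_eq_zero_iff, symCocycles_mem_coboundaries_iff' hd0]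
    exact ⟨0, by rw [h, eq_zero_of_mem_symbolsBelow_zero hP, map_zero, zero_mul]⟩
  | succ k ih =>
    intro K P hP h
    obtain ⟨heven, W, hW⟩ := symCocycles_symbol hd0 hP h
    rcases Nat.even_or_odd k with hk | hk
    · obtain ⟨v, hv, hv0, -⟩ := ih K P (heven hk) h
      refine ⟨v, hv, fun j hj => hv0 j (by omega), fun j hj => ?_⟩
      obtain rfl : k = j := by omega
      exact absurd j.2 (Nat.not_odd_iff_even.2 hk)
    · obtain ⟨V, Q, hV, ht, hPV, -, hQ⟩ := exists_trace_free_add_pSq_mul hd0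
        (homogeneousComponent_isHomogeneous k P)
      set U : conformalKilling d k :=
        ⟨V, trace_free_part_mem_conformalKilling hP hW hV ht hPV⟩ with hU
      obtain ⟨P₁, hP₁, h₁⟩ := conformalLift_spec hd ⟨k, hk⟩ U
      obtain ⟨L, hL, E, hE, h₂⟩ := exists_trivial_symbol hk hQ
      obtain ⟨w, hw, hw0, -⟩ := ih (K - conformalLift hd ⟨k, hk⟩ U - L)
        (P - homogeneousComponent k P - P₁ - E)
        (Submodule.sub_mem _ (Submodule.sub_mem _
          (sub_homogeneousComponent_mem_symbolsBelow hP) hP₁) hE) (by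
          change K.1 0 0 - (conformalLift hd ⟨k, hk⟩ U).1 0 0 - L.1 0 0 = _
          rw [h, h₁, h₂, ← map_sub, ← map_sub, hPV]
          congr 1
          change P - (V + P₁) - (pSq d * Q + E) = _
          abel)
      set u : OddConformalKilling d :=
        DirectSum.of (fun j : {j : ℕ // Odd j} => conformalKilling d j) ⟨k, hk⟩ U with hu
      refine ⟨w + u, ?_, fun j hj => ?_, fun j hj => ?_⟩
      · rw [map_add, hw, conformalClass_apply, hu, conformalLiftSum_of, SymCohomology.mk_sub,
          SymCohomology.mk_sub, (SymCohomology.mk_eq_zero_iff L).2 hL, sub_zero, sub_add_cancel]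
      · rw [DirectSum.add_apply, hw0 j (by omega), zero_add, hu]
        exact DirectSum.of_eq_of_ne _ _ _ fun hjk => by
          have := congrArg Subtype.val hjk
          simp only at this
          omega
      · obtain rfl : j = ⟨k, hk⟩ := Subtype.ext (by simpa using hj.symm)
        refine ⟨Q, ?_⟩
        rw [DirectSum.add_apply, hw0 _ le_rfl, zero_add, hu, DirectSum.of_eq_same]
        exact hPV

/-- The isomorphism between classes of variational symmetries and conformal Killing tensors. -/
def symCohomologyEquiv {d : ℕ} (hd : 3 ≤ d) : SymCohomology d ≃ₗ[ℝ] OddConformalKilling d :=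
  (LinearEquiv.ofBijective (conformalClass hd) ⟨conformalClass_injective hd, fun a => by
    obtain ⟨K, rfl⟩ := SymCohomology.mk_surjective a
    obtain ⟨P, hP⟩ := normalOrder_surjective (K.1 0 0)
    obtain ⟨n, hn⟩ := exists_mem_symbolsBelow P
    obtain ⟨v, hv, -⟩ := exists_conformalClass_eq hd n K P hn hP
    exact ⟨v, hv⟩⟩).symm

theorem symCohomologyEquiv_eq_iff {d : ℕ} (hd : 3 ≤ d) {a : SymCohomology d}
    {v : OddConformalKilling d} : symCohomologyEquiv hd a = v ↔ conformalClass hd v = a := by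
  unfold symCohomologyEquiv
  rw [LinearEquiv.symm_apply_eq, eq_comm]
  rfl

end MasslessScalar

end

theorem mainTheorem9 (d : ℕ) (hd : 3 ≤ d) :
    -- symplectic cocycles are the linear variational symmetries of the action
    (∀ A : DiffOp d, IsVariationalSymmetry A ↔ ∃! K : symCocycles d, K.1 0 0 = A) ∧
    -- trivial ones are those vanishing on-shell, `A = D □` with `D` anti-self-adjoint
    (∀ K : symCocycles d, K ∈ symCoboundaries d ↔
      ∃ D : DiffOp d, IsAntiSelfAdjointOp D ∧ K.1 0 0 = D * box d) ∧
    -- the anti-self-adjoint part of Eastwood's algebra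
    (∃ (ε : Cohomology d ≃ₐ[ℝ] EastwoodAlgebra d) (ι : SymCohomology d →ₗ⁅ℝ⁆ Cohomology d),
      (∀ (K : Cocycle d) (A : EomSymmetry d), A.1 = K.1 0 0 →
        ε (Ideal.Quotient.mk (coboundaries d) K) = Ideal.Quotient.mk (eomTrivial d) A) ∧
      (∀ (K : symCocycles d) (K' : Cocycle d), K'.1 = K.1 →
        ι (SymCohomology.mk K) = Ideal.Quotient.mk (coboundaries d) K') ∧
      Function.Injective ι ∧
      Set.range ι = {a | IsAntiSelfAdjointClass a}) ∧
    -- the isomorphism with conformal Killing tensors of odd rank, through principal symbols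
    (∃ Φ : SymCohomology d ≃ₗ[ℝ] OddConformalKilling d,
      (∀ (k : {k : ℕ // Odd k}) (V : conformalKilling d k),
        ∃ (K : symCocycles d) (P : Symb d), (K.1 0 0).1 = symbolOp P ∧ P.totalDegree ≤ k ∧
          P.homogeneousComponent k = V.1 ∧
          Φ (SymCohomology.mk K) = DirectSum.of (fun j : {j : ℕ // Odd j} => conformalKilling d j) k V) ∧
      (∀ (K : symCocycles d) (P : Symb d) (k : ℕ),
        (K.1 0 0).1 = symbolOp P → P.totalDegree ≤ k →
        (∀ j : {j : ℕ // Odd j}, k < j → Φ (SymCohomology.mk K) j = 0) ∧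
        (∀ hk : Odd k, ∃ Q : Symb d,
          P.homogeneousComponent k = (Φ (SymCohomology.mk K) ⟨k, hk⟩).1 + pSq d * Q))) := by
  have hd0 : 0 < d := by omega
  refine ⟨isVariationalSymmetry_iff_existsUnique hd0, symCocycles_mem_coboundaries_iff hd0,
    ⟨cohomologyEquivEastwood hd0, symCohomologyToCohomology hd0,
      fun K A h => cohomologyEquivEastwood_mk hd0 h, fun K K' h => ?_,
      symCohomologyToCohomology_injective hd0, range_symCohomologyToCohomology hd0⟩,
    symCohomologyEquiv hd, fun k V => ?_, fun K P k h hk => ?_⟩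
  · rw [symCohomologyToCohomology_mk]
    exact congrArg (Ideal.Quotient.mk (coboundaries d))
      (show symCocycleToCocycle d K = K' from Subtype.ext h.symm)
  · obtain ⟨P, hP, h⟩ := conformalLift_spec hd k V
    refine ⟨conformalLift hd k V, V.1 + P, congrArg Subtype.val h,
      mem_symbolsBelow_succ_iff.1 (Submodule.add_mem _
        (mem_symbolsBelow_of_isHomogeneous V.2.1 (Nat.lt_succ_self _))
        (symbolsBelow_mono (Nat.le_succ _) hP)),
      homogeneousComponent_eq_of_sub_mem V.2.1 (by rwa [add_sub_cancel_left]), ?_⟩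
    rw [symCohomologyEquiv_eq_iff, conformalClass_apply, conformalLiftSum_of]
  · obtain ⟨v, hv, hv0, hvk⟩ := exists_conformalClass_eq hd (k + 1) K P
      (mem_symbolsBelow_succ_iff.2 hk) (eq_normalOrder h)
    rw [(symCohomologyEquiv_eq_iff hd).2 hv]
    exact ⟨hv0, fun hk => hvk ⟨k, hk⟩ rfl⟩
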